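/- Theorem (Both $k$-near Editing). An instance of Both $k$-near Editing consists of a bipartite graph $G=(S\cup Q,E)$, $E\subseteq S\times Q$, with finite sides $S$ (students) and $Q$ (questions), $n=|S|+|Q|\ge 1$, bijections $\alpha:S\to\{1,\dots,|S|\}$ and $\beta:Q\to\{1,\dots,|Q|\}$ (the initial orderings), and an integer $k\ge 1$. A feasible solution consists of a set $F\subseteq S\times Q$ of edge edits and bijections $\pi:S\to\{1,\dots,|S|\}$ and $\tau:Q\to\{1,\dots,|Q|\}$ such that (i) $|\pi(s)-\alpha(s)|\le k$ for all $s\in S$ and $|\tau(q)-\beta(q)|\le k$ for all $q\in Q$; and, writing $N(s)$ for the neighborhood of $s$ in the edited graph $(S\cup Q,\,E\,\triangle\,F)$, (ii) $\pi$ is nested: $\pi(s_1)\ge\pi(s_2)$ implies $N(s_1)\supseteq N(s_2)$; (iii) $\tau$ has the interval property: for every $s\in S$ there is $j\ge 0$ with $N(s)=\{q\in Q:\tau(q)\le j\}$. The problem is to find a feasible solution with $|F|$ minimum. It can be solved in time $O(n^3k^{4k+4})$: there are one random access machine program and one constant $C$ such that, on every instance (given by $|S|$, $|Q|$, $k$,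 the tables of $\alpha$ and $\beta$ and the adjacency matrix of $G$), the program halts after at most $C\,n^3k^{4k+4}$ steps and outputs the minimum number of edge edits together with an optimal solution $(F,\pi,\tau)$. Here additions, subtractions, multiplications, divisions with rounding, comparisons and memory accesses on words cost one step each, and all words written are at most $C\,(n^3k^{4k+4})^C$, i.e. they have $O(\log (n^3k^{4k+4})+1)$ bits. -/

import Mathlib

namespace NearEditing

/-! ### Bipartite graphs, orderings and the editing problem

A bipartite student-question graph is its edge set `E : Finset (S × Q)`.  An ordering of a side
with `m` elements is a bijection onto the positions `Fin m`; positions are numbered from `0`.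
Students are ordered from weakest to strongest, questions from easiest to hardest. -/

/-- The neighbourhood of the student `s`: the questions that `s` answered correctly. -/
def nbhd {S Q : Type*} (E : Finset (S × Q)) (s : S) : Set Q := {x | (s, x) ∈ E}

/-- The student ordering `π` is nested: a student at a later position has a larger neighbourhood. -/
def Nested {S Q : Type*} {m : ℕ} (E : Finset (S × Q)) (π : S ≃ Fin m) : Prop :=
  ∀ s₁ s₂ : S, π s₂ ≤ π s₁ → nbhd E s₂ ⊆ nbhd E s₁

/-- The question ordering `τ` has the interval property: every neighbourhood `N(s)` is a (possibly
empty) block of consecutive questions starting with the easiest one. -/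
def IntervalProperty {S Q : Type*} {p : ℕ} (E : Finset (S × Q)) (τ : Q ≃ Fin p) : Prop :=
  ∀ s : S, ∃ j : ℕ, nbhd E s = {x | (τ x : ℕ) < j}

/-- `π` is `k`-near `α`: every position `π x` lies in `[α x - k, α x + k]`. -/
def KNear {X : Type*} {m : ℕ} (k : ℕ) (α π : X ≃ Fin m) : Prop :=
  ∀ x : X, (α x : ℤ) - k ≤ (π x : ℤ) ∧ (π x : ℤ) ≤ (α x : ℤ) + k

/-- An instance: `numS` students, `numQ` questions, the graph, the two initial orderings and `k`. -/
structure NearInstance where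
  numS : ℕ
  numQ : ℕ
  k : ℕ
  α : Fin numS ≃ Fin numS
  β : Fin numQ ≃ Fin numQ
  edges : Finset (Fin numS × Fin numQ)

/-- The edit set `F` (pairs whose adjacency is flipped) with the orderings `π`, `τ` is feasible. -/
def Feasible (I : NearInstance) (F : Finset (Fin I.numS × Fin I.numQ))
    (π : Fin I.numS ≃ Fin I.numS) (τ : Fin I.numQ ≃ Fin I.numQ) : Prop :=
  KNear I.k I.α π ∧ KNear I.k I.β τ ∧
    Nested (symmDiff I.edges F) π ∧ IntervalProperty (symmDiff I.edges F) τ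

/-- A feasible solution with the least possible number of edge edits. -/
def IsOptimal (I : NearInstance) (F : Finset (Fin I.numS × Fin I.numQ))
    (π : Fin I.numS ≃ Fin I.numS) (τ : Fin I.numQ ≃ Fin I.numQ) : Prop :=
  Feasible I F π τ ∧ ∀ F' π' τ', Feasible I F' π' τ' → F.card ≤ F'.card

/-! ### Random access machine

Structured programs over finitely many registers and an addressable memory of natural-number
words.  Every assignment, store and test costs one step. -/

/-- Arithmetic on words: subtraction is truncated at `0`, division rounds down. -/
inductive Op
  | add | sub | mul | div

def Op.eval : Op → ℕ → ℕ → ℕ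
  | .add, a, b => a + b
  | .sub, a, b => a - b
  | .mul, a, b => a * b
  | .div, a, b => a / b

structure State where
  reg : ℕ → ℕ
  mem : ℕ → ℕ

/-- What a single assignment can compute: a constant, a copy, one operation, one memory access. -/
inductive Rhs
  | const (c : ℕ)
  | copy (r : ℕ)
  | op (o : Op) (r₁ r₂ : ℕ)
  | load (r : ℕ)

def Rhs.eval (σ : State) : Rhs → ℕ
  | .const c => c
  | .copy r => σ.reg r
  | .op o r₁ r₂ => o.eval (σ.reg r₁) (σ.reg r₂)
  | .load r => σ.mem (σ.reg r)

/-- Comparison of two registers. -/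
inductive Test
  | lt (r₁ r₂ : ℕ)
  | eq (r₁ r₂ : ℕ)

def Test.Holds (σ : State) : Test → Prop
  | .lt r₁ r₂ => σ.reg r₁ < σ.reg r₂
  | .eq r₁ r₂ => σ.reg r₁ = σ.reg r₂

/-- Programs.  `store a r` writes register `r` to the memory cell addressed by register `a`;
`branch` is if-then-else and `loop` is a while loop. -/
inductive Prog
  | skip
  | assign (r : ℕ) (e : Rhs)
  | store (a r : ℕ)
  | seq (P₁ P₂ : Prog)
  | branch (b : Test) (P₁ P₂ : Prog)
  | loop (b : Test) (P : Prog)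

/-- `Exec B P σ t σ'`: started in state `σ`, the program `P` halts in state `σ'` after exactly `t`
steps, and every word written on the way is at most `B` (an overflow leaves no execution). -/
inductive Exec (B : ℕ) : Prog → State → ℕ → State → Prop
  | skip (σ : State) : Exec B .skip σ 1 σ
  | assign (σ : State) (r : ℕ) (e : Rhs) (hB : e.eval σ ≤ B) :
      Exec B (.assign r e) σ 1 ⟨Function.update σ.reg r (e.eval σ), σ.mem⟩
  | store (σ : State) (a r : ℕ) (hB : σ.reg r ≤ B) :
      Exec B (.store a r) σ 1 ⟨σ.reg, Function.update σ.mem (σ.reg a) (σ.reg r)⟩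
  | seq {P₁ P₂ : Prog} {σ₁ σ₂ σ₃ : State} {t₁ t₂ : ℕ}
      (h₁ : Exec B P₁ σ₁ t₁ σ₂) (h₂ : Exec B P₂ σ₂ t₂ σ₃) :
      Exec B (.seq P₁ P₂) σ₁ (t₁ + t₂) σ₃
  | branch_true {b : Test} {P₁ P₂ : Prog} {σ σ' : State} {t : ℕ}
      (hb : b.Holds σ) (h : Exec B P₁ σ t σ') :
      Exec B (.branch b P₁ P₂) σ (1 + t) σ'
  | branch_false {b : Test} {P₁ P₂ : Prog} {σ σ' : State} {t : ℕ}
      (hb : ¬ b.Holds σ) (h : Exec B P₂ σ t σ') :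
      Exec B (.branch b P₁ P₂) σ (1 + t) σ'
  | loop_false {b : Test} {P : Prog} {σ : State} (hb : ¬ b.Holds σ) :
      Exec B (.loop b P) σ 1 σ
  | loop_true {b : Test} {P : Prog} {σ₁ σ₂ σ₃ : State} {t₁ t₂ : ℕ}
      (hb : b.Holds σ₁) (h₁ : Exec B P σ₁ t₁ σ₂) (h₂ : Exec B (.loop b P) σ₂ t₂ σ₃) :
      Exec B (.loop b P) σ₁ (1 + t₁ + t₂) σ₃

/-! ### Input and output -/

/-- The table of positions of an ordering. -/
def permList {m : ℕ} (π : Fin m ≃ Fin m) : List ℕ := List.ofFn fun i => (π i : ℕ)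

/-- The 0-1 matrix of a set of pairs, row by row: the entry for `(i, j)` has index `p * i + j`. -/
def matrixList {m p : ℕ} (E : Finset (Fin m × Fin p)) : List ℕ :=
  List.ofFn fun a : Fin (m * p) => if finProdFinEquiv.symm a ∈ E then 1 else 0

def NearInstance.encode (I : NearInstance) : List ℕ :=
  [I.numS, I.numQ, I.k] ++ permList I.α ++ permList I.β ++ matrixList I.edges

/-- The initial state: the input at the start of the memory, and `0` everywhere else. -/
def NearInstance.initial (I : NearInstance) : State :=
  ⟨fun _ => 0, fun a => I.encode.getD a 0⟩

/-- The output for a solution: the number of edits, the two orderings and the edit set. -/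
def encodeSolution {m p : ℕ} (F : Finset (Fin m × Fin p)) (π : Fin m ≃ Fin m)
    (τ : Fin p ≃ Fin p) : List ℕ :=
  [F.card] ++ permList π ++ permList τ ++ matrixList F

/-- The memory of `σ` starts with the words of `l`. -/
def State.Outputs (σ : State) (l : List ℕ) : Prop :=
  ∀ (a : ℕ) (h : a < l.length), σ.mem a = l[a]

end NearEditing

/-!
After the edits the graph is a chain graph: it is given by one interleaving of the students and the
questions, in which each student is adjacent to exactly the questions that come before it.  So a
feasible solution amounts to placing all elements one after another, students in the order `π` and
questions in the order `τ`; the cost is paid when a student is placed, as the number of pairs in its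
row that differ from the set of questions placed so far.

Since `π` is `k`-near `α`, the set of the first `i` students contains every student with initial
position below `i - k` and none with initial position `i + k` or above.  It is therefore described by
a bit mask of a window of `2 * k + 1` positions (`IsWindow`), and likewise for the questions.  This
leaves at most `(m + 1) * (p + 1) * 4 ^ (2 * k + 1)` configurations (`Config`) for `m` students and
`p` questions.  No check is needed that an element leaving the window has been placed: a sequence of
moves that loses an element cannot place all elements any more.

`value` is the least cost of completing a configuration.  It satisfies the recursion of
`Move.value_le` and `exists_move_of_value_lt`.  At the start it is the optimum: a feasible solution
is a completion of the same cost (`Feasible.completion`), and a completed sequence of moves is a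
feasible solution of the same cost (`Partial.exists_feasible`).

The program fills a table of all values in descending order of a mixed radix code (`tableProg`), then
follows optimal moves from the start, recording the new positions and, for each student, the number
of questions placed before it (`traceProg`); from these it writes the edit matrix (`matrixProg`).
Each configuration has at most `2 * (2 * k + 1)` moves, and trying one takes `O(n * k)` steps, mostly
for reading a bit of the mask for each question of a row.  The total of `O(n ^ 3 * k ^ 2 * 16 ^ k)`
is within the claimed bound because `16 ^ k ≤ k ^ (4 * k)` for `k ≥ 2` (`states_mul_le`).

Programs are verified by symbolic execution: `Runs` is a total correctness triple with running time,
and `runs_loop` is the rule for counting loops.  A subprogram leaves all registers below some number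
unchanged (`Frame`), so callers keep their data in low registers.
-/

namespace NearEditing

-- the symbolic execution steps share one list of simplification rules
set_option linter.unusedSimpArgs false

/-! ### Windows of an ordering as bit masks -/

/-- The mask `a` records the placed set `P` when `i` positions are filled: its bit `e` tells whether
the element at position `i + e - k` of the initial ordering `α` is placed.  An element of `P` whose
position has dropped below `i - k` is no longer recorded. -/
def IsWindow {m : ℕ} (k : ℕ) (α : Fin m ≃ Fin m) (i a : ℕ) (P : Fin m → Prop) : Prop :=
  ∀ e, a.testBit e = true ↔ ∃ s, P s ∧ (α s : ℕ) + k = i + e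

/-- The element at initial position `r` may be placed at position `i`, given the mask `a`. -/
def Fits (k i a r : ℕ) : Prop :=
  i ≤ r + k ∧ r ≤ i + k ∧ a.testBit (r + k - i) = false

/-- The mask after placing the element at initial position `r` at position `i`. -/
def place (k i a r : ℕ) : ℕ := (a + 2 ^ (r + k - i)) / 2

/-- The element at initial position `r` counts as placed among the first `j`, according to the
mask `b`; everything below the window is taken as placed. -/
def Seen (k j b r : ℕ) : Prop := r + k < j ∨ b.testBit (r + k - j) = true

instance (k j b r : ℕ) : Decidable (Seen k j b r) := inferInstanceAs (Decidable (_ ∨ _))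

/-- Adding a power of two whose bit is clear causes no carry. -/
theorem testBit_add_two_pow_of_clear (t : ℕ) :
    ∀ (a e : ℕ), a.testBit t = false →
      ((a + 2 ^ t).testBit e = true ↔ e = t ∨ a.testBit e = true) := by
  induction t with
  | zero =>
    intro a e h
    have h2 : a % 2 = 0 := by
      rw [Nat.testBit_zero] at h
      simpa using h
    cases e with
    | zero => simp [Nat.testBit_zero]; omega
    | succ e =>
      rw [Nat.testBit_add_one, Nat.testBit_add_one]
      have : (a + 2 ^ 0) / 2 = a / 2 := by simp; omega
      rw [this]; simp
  | succ t ih =>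
    intro a e h
    rw [Nat.testBit_add_one] at h
    cases e with
    | zero => simp [Nat.testBit_zero, pow_succ, Nat.add_mod]
    | succ e =>
      rw [Nat.testBit_add_one, Nat.testBit_add_one]
      have : (a + 2 ^ (t + 1)) / 2 = a / 2 + 2 ^ t := by rw [pow_succ]; omega
      rw [this, ih _ _ h]; simp

theorem place_lt {k i a r : ℕ} (ha : a < 2 ^ (2 * k + 1)) (hr : r ≤ i + k) :
    place k i a r < 2 ^ (2 * k + 1) := by
  have : 2 ^ (r + k - i) ≤ 2 ^ (2 * k + 1) := Nat.pow_le_pow_right (by norm_num) (by omega)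
  unfold place
  omega

section Window
variable {m k i a : ℕ} {α : Fin m ≃ Fin m} {P : Fin m → Prop}

theorem isWindow_zero (hP : ∀ s, ¬ P s) : IsWindow k α 0 0 P := by
  intro e
  simp [hP]

theorem IsWindow.testBit_iff (h : IsWindow k α i a P) {s : Fin m} (hi : i ≤ (α s : ℕ) + k) :
    a.testBit ((α s : ℕ) + k - i) = true ↔ P s := by
  rw [h]
  constructor
  · rintro ⟨s', hs', he⟩
    have : α s' = α s := Fin.ext (by omega)
    rwa [← α.injective this]
  · intro hs
    exact ⟨s, hs, by omega⟩

/-- For a mask that describes the set `P`, `Seen` differs from `P` at most below the window; for the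
first `i` elements of an ordering near `α` there is no difference. -/
theorem IsWindow.seen_iff (h : IsWindow k α i a P) (s : Fin m) :
    Seen k i a (α s) ↔ (α s : ℕ) + k < i ∨ P s := by
  unfold Seen
  by_cases hlt : (α s : ℕ) + k < i
  · simp [hlt]
  · rw [h.testBit_iff (by omega)]

/-- An element fits if it lies in the window and is not placed yet. -/
theorem IsWindow.fits_iff (h : IsWindow k α i a P) (s : Fin m) :
    Fits k i a (α s) ↔ i ≤ (α s : ℕ) + k ∧ (α s : ℕ) ≤ i + k ∧ ¬ P s := by
  unfold Fits
  by_cases hi : i ≤ (α s : ℕ) + k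
  · rw [← h.testBit_iff hi, Bool.not_eq_true]
  · simp [hi]

theorem IsWindow.place (h : IsWindow k α i a P) {s : Fin m} (hs : Fits k i a (α s))
    {P' : Fin m → Prop} (hP' : ∀ s', P' s' ↔ P s' ∨ s' = s) :
    IsWindow k α (i + 1) (place k i a (α s)) P' := by
  intro e
  unfold NearEditing.place
  rw [← Nat.testBit_add_one, testBit_add_two_pow_of_clear _ _ _ hs.2.2, h]
  have := hs.1
  constructor
  · rintro (he | ⟨s', hs', he⟩)
    · exact ⟨s, (hP' s).2 (Or.inr rfl), by omega⟩
    · exact ⟨s', (hP' s').2 (Or.inl hs'), by omega⟩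
  · rintro ⟨s', hs', he⟩
    rcases (hP' s').1 hs' with h1 | rfl
    · exact Or.inr ⟨s', h1, by omega⟩
    · exact Or.inl (by omega)

end Window

/-! ### Moves, completions and the value of a configuration -/

/-- A configuration of the dynamic program: `i` students and `j` questions are placed, `a` and `b`
are the masks of the two windows. -/
structure Config where
  i : ℕ
  j : ℕ
  a : ℕ
  b : ℕ

/-- The number of edits in the row of the student `s` if exactly the questions that `b` shows as
placed among the first `j` are to be adjacent to `s`. -/
def rowCost (I : NearInstance) (s : Fin I.numS) (j b : ℕ) : ℕ :=
  ∑ q : Fin I.numQ, if ((s, q) ∈ I.edges ↔ Seen I.k j b (I.β q)) then 0 else 1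

/-- `Move I c u x w c'`: the move with index `u` leads from `c` to `c'` at cost `w`, and it places
the element with index `x`, where students come before questions.  Placing a student when `j`
questions are placed makes these `j` questions its neighbourhood. -/
inductive Move (I : NearInstance) : Config → ℕ → ℕ → ℕ → Config → Prop
  | student {i j a b : ℕ} (s : Fin I.numS) (hi : i < I.numS) (hs : Fits I.k i a (I.α s)) :
      Move I ⟨i, j, a, b⟩ ((I.α s : ℕ) + I.k - i) s (rowCost I s j b)
        ⟨i + 1, j, place I.k i a (I.α s), b⟩
  | question {i j a b : ℕ} (q : Fin I.numQ) (hj : j < I.numQ) (hq : Fits I.k j b (I.β q)) :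
      Move I ⟨i, j, a, b⟩ (2 * I.k + 1 + ((I.β q : ℕ) + I.k - j)) (I.numS + q) 0
        ⟨i, j + 1, a, place I.k j b (I.β q)⟩

/-- `Completion I c v`: some sequence of moves of total cost `v` places everything, from `c` on. -/
inductive Completion (I : NearInstance) : Config → ℕ → Prop
  | done (a b : ℕ) : Completion I ⟨I.numS, I.numQ, a, b⟩ 0
  | step {c c' : Config} {u x w v : ℕ} (hm : Move I c u x w c') (h : Completion I c' v) :
      Completion I c (w + v)

/-- A number larger than every cost that matters; it stands for infinity. -/
def cap (I : NearInstance) : ℕ := I.numS * I.numQ + 1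

/-- The least cost of a completion of `c`, cut off at `cap I`. -/
noncomputable def value (I : NearInstance) (c : Config) : ℕ :=
  sInf (insert (cap I) {v | Completion I c v})

section Value
variable {I : NearInstance} {c c' : Config} {u x w v : ℕ}

theorem value_le_cap (I : NearInstance) (c : Config) : value I c ≤ cap I :=
  Nat.sInf_le (Set.mem_insert _ _)

theorem Completion.value_le (h : Completion I c v) : value I c ≤ v :=
  Nat.sInf_le (Set.mem_insert_of_mem _ h)

theorem completion_value (h : value I c < cap I) : Completion I c (value I c) := by
  have : value I c ∈ insert (cap I) {v | Completion I c v} :=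
    Nat.sInf_mem ⟨_, Set.mem_insert _ _⟩
  rcases this with h1 | h1
  · omega
  · exact h1

theorem value_done (I : NearInstance) (a b : ℕ) : value I ⟨I.numS, I.numQ, a, b⟩ = 0 :=
  Nat.le_zero.1 (Completion.done a b).value_le

theorem Move.value_le (h : Move I c u x w c') : value I c ≤ w + value I c' := by
  by_cases hc : value I c' < cap I
  · exact (Completion.step h (completion_value hc)).value_le
  · have := value_le_cap I c
    omega

/-- The recursion that defines the table: together with `Move.value_le` it says that the value of an
unfinished configuration is the minimum over its moves. -/
theorem exists_move_of_value_lt (h : value I c < cap I) (hc : c.i ≠ I.numS ∨ c.j ≠ I.numQ) :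
    ∃ u x w c', Move I c u x w c' ∧ value I c = w + value I c' := by
  have h1 := completion_value h
  generalize hv : value I c = v at h1
  cases h1 with
  | done a b => simp at hc
  | step hm h2 => exact ⟨_, _, _, _, hm, by have := h2.value_le; have := hm.value_le; omega⟩

theorem Move.index_lt (h : Move I c u x w c') : u < 2 * (2 * I.k + 1) := by
  cases h with
  | student s hi hs => have := hs.2.1; omega
  | question q hj hq => have := hq.2.1; omega

/-- The index determines the move. -/
theorem Move.unique {x₂ w₂ : ℕ} {c₂ : Config} (h : Move I c u x w c')
    (h₂ : Move I c u x₂ w₂ c₂) : x = x₂ ∧ w = w₂ ∧ c' = c₂ := by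
  generalize hu : u = u' at h₂
  cases h with
  | student s hi hs =>
    cases h₂ with
    | student s' hi' hs' =>
      have := hs.1; have := hs'.1
      have : I.α s = I.α s' := Fin.ext (by omega)
      obtain rfl := I.α.injective this
      exact ⟨rfl, rfl, rfl⟩
    | question q hj hq => have := hs.2.1; omega
  | question q hj hq =>
    cases h₂ with
    | student s' hi' hs' => have := hs'.2.1; omega
    | question q' hj' hq' =>
      have := hq.1; have := hq'.1
      have : I.β q = I.β q' := Fin.ext (by omega)
      obtain rfl := I.β.injective this
      exact ⟨rfl, rfl, rfl⟩

end Value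

/-! ### Every feasible solution is a completion -/

section Completeness
variable {I : NearInstance} {F : Finset (Fin I.numS × Fin I.numQ)}
  {π : Fin I.numS ≃ Fin I.numS} {τ : Fin I.numQ ≃ Fin I.numQ}

/-- In a feasible solution the cost of the row of `s` is the number of edits at `s`, provided `s` is
placed when exactly its neighbours are. -/
theorem rowCost_eq_card_row {s : Fin I.numS} {j b : ℕ} (hτ : KNear I.k I.β τ)
    (hb : IsWindow I.k I.β j b fun q => (τ q : ℕ) < j)
    (hs : nbhd (symmDiff I.edges F) s = {q | (τ q : ℕ) < j}) :
    rowCost I s j b = ∑ q : Fin I.numQ, if (s, q) ∈ F then 1 else 0 := by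
  unfold rowCost
  refine Finset.sum_congr rfl fun q _ => ?_
  have h1 : Seen I.k j b (I.β q) ↔ (τ q : ℕ) < j := by
    rw [hb.seen_iff]
    have := hτ q
    omega
  have h2 : (s, q) ∈ symmDiff I.edges F ↔ (τ q : ℕ) < j := by
    exact Set.ext_iff.1 hs q
  rw [Finset.mem_symmDiff] at h2
  by_cases h3 : (s, q) ∈ F <;> simp [h1, h3, ← h2]

/-- A feasible solution yields a sequence of moves: each student `s` is placed, in the order `π`, as
soon as its `J s` neighbours are, and the questions are placed in the order `τ`.  The induction is
on the number `n` of elements that remain to be placed. -/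
theorem completion_of_staircase {J : Fin I.numS → ℕ} (hπ : KNear I.k I.α π)
    (hτ : KNear I.k I.β τ) (hJ : ∀ s, nbhd (symmDiff I.edges F) s = {q | (τ q : ℕ) < J s})
    (hJle : ∀ s, J s ≤ I.numQ) (hmono : ∀ s₁ s₂, π s₂ ≤ π s₁ → J s₂ ≤ J s₁) (n : ℕ) :
    ∀ i j a b : ℕ, n = (I.numS - i) + (I.numQ - j) → i ≤ I.numS → j ≤ I.numQ →
      (IsWindow I.k I.α i a fun s => (π s : ℕ) < i) →
      (IsWindow I.k I.β j b fun q => (τ q : ℕ) < j) →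
      (∀ s, i ≤ (π s : ℕ) → j ≤ J s) →
      Completion I ⟨i, j, a, b⟩
        (∑ s, if i ≤ (π s : ℕ) then (∑ q : Fin I.numQ, if (s, q) ∈ F then 1 else 0) else 0) := by
  induction n with
  | zero =>
    intro i j a b hn hi hj _ _ _
    obtain rfl : i = I.numS := by omega
    obtain rfl : j = I.numQ := by omega
    rw [Finset.sum_eq_zero]
    · exact Completion.done a b
    · intro s _
      rw [if_neg]
      have := (π s).2
      omega
  | succ n ih =>
    intro i j a b hn hi hj ha hb hJj
    have hquestion : ∀ (hj : j < I.numQ), (∀ s, i ≤ (π s : ℕ) → j + 1 ≤ J s) →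
      Completion I ⟨i, j, a, b⟩
        (∑ s, if i ≤ (π s : ℕ) then (∑ q : Fin I.numQ, if (s, q) ∈ F then 1 else 0) else 0) := by
      intro hj hJj'
      have hq : (τ (τ.symm ⟨j, hj⟩) : ℕ) = j := by simp
      have hfit : Fits I.k j b (I.β (τ.symm ⟨j, hj⟩)) := by
        rw [hb.fits_iff]
        have := hτ (τ.symm ⟨j, hj⟩)
        omega
      have := Completion.step (Move.question (i := i) (a := a) _ hj hfit)
        (ih i (j + 1) a _ (by omega) hi hj ha (hb.place hfit (P' := fun q => (τ q : ℕ) < j + 1) (by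
          intro q
          rw [Nat.lt_succ_iff_lt_or_eq, Equiv.eq_symm_apply, Fin.ext_iff])) hJj')
      rwa [zero_add] at this
    by_cases him : i < I.numS
    · have hs : (π (π.symm ⟨i, him⟩) : ℕ) = i := by simp
      set s := π.symm ⟨i, him⟩ with hsdef
      by_cases hjs : j < J s
      · refine hquestion (hjs.trans_le (hJle s)) fun s' hs' => ?_
        have := hmono s' s (Fin.le_def.2 (by omega))
        omega
      · have hjs' : J s = j := by have := hJj s hs.ge; omega
        have hfit : Fits I.k i a (I.α s) := by
          rw [ha.fits_iff]
          have := hπ s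
          omega
        have h1 := Completion.step (Move.student (j := j) (b := b) s him hfit)
          (ih (i + 1) j _ b (by omega) him hj
            (ha.place hfit (P' := fun s => (π s : ℕ) < i + 1) (by
              intro s'
              rw [Nat.lt_succ_iff_lt_or_eq, hsdef, Equiv.eq_symm_apply, Fin.ext_iff])) hb
            (by
              intro s' hs'
              have := hmono s' s (Fin.le_def.2 (by omega))
              omega))
        rw [rowCost_eq_card_row hτ hb (by rw [hJ, hjs'])] at h1
        convert h1 using 1
        rw [← Finset.add_sum_erase _ _ (Finset.mem_univ s),
          ← Finset.add_sum_erase (a := s) (s := Finset.univ) (f := fun s => if i + 1 ≤ (π s : ℕ)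
            then (∑ q : Fin I.numQ, if (s, q) ∈ F then 1 else 0) else 0) (Finset.mem_univ s),
          if_pos hs.ge, if_neg (by omega), zero_add]
        congr 1
        refine Finset.sum_congr rfl fun s' hs' => ?_
        have hne : (π s' : ℕ) ≠ i := fun h => (Finset.mem_erase.1 hs').1 (by
          rw [hsdef, Equiv.eq_symm_apply]; exact Fin.ext h)
        have : i ≤ (π s' : ℕ) ↔ i + 1 ≤ (π s' : ℕ) := by omega
        simp only [this]
    · refine hquestion (by omega) fun s hs => ?_
      have := (π s).2
      omega

theorem card_eq_sum_rows {m p : ℕ} (F : Finset (Fin m × Fin p)) :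
    F.card = ∑ s, ∑ q, if (s, q) ∈ F then 1 else 0 := by
  rw [← Finset.sum_product' (f := fun s q => if (s, q) ∈ F then 1 else 0)]
  simp

/-- The neighbourhood sizes of a feasible solution are monotone along `π`, so it is a staircase. -/
theorem Feasible.completion (h : Feasible I F π τ) : Completion I ⟨0, 0, 0, 0⟩ F.card := by
  obtain ⟨hπ, hτ, hnest, hint⟩ := h
  choose J₀ hJ₀ using hint
  have hJ : ∀ s, nbhd (symmDiff I.edges F) s = {q | (τ q : ℕ) < min (J₀ s) I.numQ} := by
    intro s
    rw [hJ₀]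
    ext q
    have := (τ q).2
    simp only [Set.mem_ofPred_eq]
    omega
  have hmono : ∀ s₁ s₂, π s₂ ≤ π s₁ → min (J₀ s₂) I.numQ ≤ min (J₀ s₁) I.numQ := by
    intro s₁ s₂ h12
    by_contra! hlt
    have hlt' : min (J₀ s₁) I.numQ < I.numQ := by omega
    have hsub := hnest s₁ s₂ h12
    rw [hJ, hJ] at hsub
    have := @hsub (τ.symm ⟨_, hlt'⟩) (by
      rw [Set.mem_ofPred_eq, Equiv.apply_symm_apply]; exact hlt)
    simp at this
    omega
  have := completion_of_staircase hπ hτ hJ (fun s => min_le_right _ _) hmono _ 0 0 0 0 rfl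
    (Nat.zero_le _) (Nat.zero_le _) (isWindow_zero (by simp)) (isWindow_zero (by simp)) (by simp)
  rw [card_eq_sum_rows]
  simpa using this

/-- Deleting all edges and keeping both orderings is feasible, so the cut-off does not matter. -/
theorem value_start_lt_cap (I : NearInstance) : value I ⟨0, 0, 0, 0⟩ < cap I := by
  have h : Feasible I I.edges I.α I.β := by
    refine ⟨fun x => by omega, fun x => by omega, ?_, ?_⟩
    · intro s₁ s₂ _
      simp [nbhd]
    · intro s
      exact ⟨0, by simp [nbhd]⟩
  have h1 := h.completion.value_le
  have h2 : I.edges.card ≤ I.numS * I.numQ := by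
    simpa using Finset.card_le_univ I.edges
  unfold cap
  omega

end Completeness

/-! ### A complete sequence of moves is a feasible solution -/

/-- One side of a partial solution: `pos s` is the new position of the element `s`, or `m` as long
as `s` is not placed.  The first `i` positions are filled, and `a` is the mask of the window. -/
structure Placing {m : ℕ} (k : ℕ) (α : Fin m ≃ Fin m) (i a : ℕ) (pos : Fin m → ℕ) : Prop where
  le : i ≤ m
  surj : ∀ i₀ < i, ∃ s, pos s = i₀
  near : ∀ s, pos s < i → (pos s ≤ (α s : ℕ) + k ∧ (α s : ℕ) ≤ pos s + k)
  unplaced : ∀ s, pos s < i ∨ pos s = m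
  window : IsWindow k α i a fun s => pos s < i

section Placing
variable {m k i a : ℕ} {α : Fin m ≃ Fin m} {pos : Fin m → ℕ}

theorem Placing.zero (k : ℕ) (α : Fin m ≃ Fin m) : Placing k α 0 0 fun _ => m where
  le := Nat.zero_le _
  surj := by simp
  near := by simp
  unplaced := by simp
  window := isWindow_zero (by simp)

theorem Placing.pos_eq (h : Placing k α i a pos) {s : Fin m} (hs : Fits k i a (α s)) :
    pos s = m :=
  (h.unplaced s).resolve_left ((h.window.fits_iff s).1 hs).2.2

/-- A fitting element is placed at the next position. -/
theorem Placing.step (h : Placing k α i a pos) {s : Fin m} (hs : Fits k i a (α s)) (hi : i < m) :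
    Placing k α (i + 1) (place k i a (α s)) (Function.update pos s i) := by
  have hlt : ∀ s', Function.update pos s i s' < i + 1 ↔ pos s' < i ∨ s' = s := by
    intro s'
    by_cases hss : s' = s
    · simp [hss]
    · have := h.unplaced s'
      simp only [Function.update_of_ne hss, hss, or_false]
      omega
  refine ⟨hi, ?_, ?_, ?_, h.window.place hs hlt⟩
  · intro i₀ hi₀
    by_cases he : i₀ = i
    · exact ⟨s, by simp [he]⟩
    · obtain ⟨s', hs'⟩ := h.surj i₀ (by omega)
      refine ⟨s', ?_⟩
      rw [Function.update_of_ne, hs']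
      rintro rfl
      have := h.pos_eq hs
      omega
  · intro s' hs'
    by_cases hss : s' = s
    · subst hss
      simpa using ⟨hs.1, hs.2.1⟩
    · rw [hlt] at hs'
      simpa [Function.update_of_ne hss] using h.near s' (hs'.resolve_right hss)
  · intro s'
    by_cases hss : s' = s
    · simp [hss]
    · have := h.unplaced s'
      simp only [Function.update_of_ne hss]
      omega

/-- Once all `m` positions are filled, the positions form an ordering: every position is taken, hence
taken once. -/
theorem Placing.exists_perm (h : Placing k α m a pos) :
    ∃ π : Fin m ≃ Fin m, (∀ s, (π s : ℕ) = pos s) ∧ KNear k α π := by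
  choose e he using fun i : Fin m => h.surj i i.2
  have hinj : Function.Injective e := fun i₁ i₂ h12 => Fin.ext (by rw [← he i₁, ← he i₂, h12])
  have hpos : ∀ s, (((Equiv.ofBijective e (Finite.injective_iff_bijective.1 hinj)).symm s : Fin m)
      : ℕ) = pos s := by
    intro s
    rw [← he]
    congr 1
    exact Equiv.ofBijective_apply_symm_apply e _ s
  refine ⟨_, hpos, fun s => ?_⟩
  have := h.near s (by rw [← hpos]; exact Fin.is_lt _)
  have := hpos s
  omega

end Placing

/-- A partial solution reached at the configuration `c` with cost `g`: positions of the students and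
of the questions, and the size `J s` of the neighbourhood given to each placed student `s`. -/
structure Partial (I : NearInstance) (c : Config) (g : ℕ) (posS J : Fin I.numS → ℕ)
    (posQ : Fin I.numQ → ℕ) : Prop where
  students : Placing I.k I.α c.i c.a posS
  questions : Placing I.k I.β c.j c.b posQ
  mono : ∀ s₁ s₂, posS s₂ ≤ posS s₁ → posS s₁ < c.i → J s₂ ≤ J s₁
  size_le : ∀ s, posS s < c.i → J s ≤ c.j
  cost : g = ∑ s, if posS s < c.i then (∑ q, if ((s, q) ∈ I.edges ↔
    ((I.β q : ℕ) + I.k < J s ∨ posQ q < J s)) then 0 else 1) else 0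

section Partial
variable {I : NearInstance} {c : Config} {g : ℕ} {posS J : Fin I.numS → ℕ} {posQ : Fin I.numQ → ℕ}

theorem Partial.zero (I : NearInstance) (J : Fin I.numS → ℕ) :
    Partial I ⟨0, 0, 0, 0⟩ 0 (fun _ => I.numS) J fun _ => I.numQ where
  students := Placing.zero _ _
  questions := Placing.zero _ _
  mono := by simp
  size_le := by simp
  cost := by simp

theorem Partial.student (h : Partial I c g posS J posQ) (s : Fin I.numS) (hi : c.i < I.numS)
    (hs : Fits I.k c.i c.a (I.α s)) :
    Partial I ⟨c.i + 1, c.j, place I.k c.i c.a (I.α s), c.b⟩ (g + rowCost I s c.j c.b)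
      (Function.update posS s c.i) (Function.update J s c.j) posQ := by
  have hpos := h.students.pos_eq hs
  refine ⟨h.students.step hs hi, h.questions, ?_, ?_, ?_⟩
  · intro s₁ s₂ h12 h1
    have hu := h.students.unplaced s₂
    by_cases e1 : s₁ = s
    · subst e1
      by_cases e2 : s₂ = s₁
      · rw [e2]
      · simp only [Function.update_self, Function.update_of_ne e2] at *
        exact h.size_le s₂ (by omega)
    · have hu₁ := h.students.unplaced s₁
      by_cases e2 : s₂ = s
      · subst e2
        simp only [Function.update_self, Function.update_of_ne e1] at *
        omega
      · simp only [Function.update_of_ne e1, Function.update_of_ne e2] at *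
        exact h.mono _ _ h12 (by omega)
  · intro s' hs'
    by_cases e1 : s' = s
    · simp [e1]
    · have hu₁ := h.students.unplaced s'
      simp only [Function.update_of_ne e1] at *
      exact h.size_le s' (by omega)
  · rw [h.cost, ← Finset.sum_erase_add (a := s) _ _ (Finset.mem_univ s),
      ← Finset.sum_erase_add (a := s) (s := Finset.univ) (f := fun s' => ite
        (Function.update posS s c.i s' < _) _ _) (Finset.mem_univ s)]
    rw [if_neg (by omega), add_zero]
    simp only [Function.update_self, Nat.lt_succ_self, if_true]
    congr 1
    · refine Finset.sum_congr rfl fun s' hs' => ?_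
      have e1 := (Finset.mem_erase.1 hs').1
      have hu := h.students.unplaced s'
      simp only [Function.update_of_ne e1]
      have : posS s' < c.i ↔ posS s' < c.i + 1 := by omega
      simp only [this]
    · unfold rowCost
      simp only [h.questions.window.seen_iff]

/-- Placing a question does not change the rows of the students placed before it, since their
neighbourhoods consist of questions at earlier positions. -/
theorem Partial.question (h : Partial I c g posS J posQ) (q : Fin I.numQ) (hj : c.j < I.numQ)
    (hq : Fits I.k c.j c.b (I.β q)) :
    Partial I ⟨c.i, c.j + 1, c.a, place I.k c.j c.b (I.β q)⟩ g posS J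
      (Function.update posQ q c.j) := by
  refine ⟨h.students, h.questions.step hq hj, h.mono, fun s hs => (h.size_le s hs).trans
    (Nat.le_succ _), ?_⟩
  rw [h.cost]
  refine Finset.sum_congr rfl fun s _ => ?_
  split_ifs with hs
  · refine Finset.sum_congr rfl fun q' _ => ?_
    have : posQ q' < J s ↔ Function.update posQ q c.j q' < J s := by
      by_cases e : q' = q
      · subst e
        have := h.questions.pos_eq hq
        have := h.size_le s hs
        rw [Function.update_self]
        omega
      · rw [Function.update_of_ne e]
    simp only [this]
  · rfl

/-- When everything is placed, every question below a window has really been placed, by nearness; so the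
rows charged along the way are the rows of the edit set that gives each student `s` its first `J s`
questions. -/
theorem Partial.exists_feasible {a b : ℕ} (h : Partial I ⟨I.numS, I.numQ, a, b⟩ g posS J posQ) :
    ∃ (F : Finset (Fin I.numS × Fin I.numQ)) (π : Fin I.numS ≃ Fin I.numS)
      (τ : Fin I.numQ ≃ Fin I.numQ), Feasible I F π τ ∧ F.card = g ∧
      (∀ s, (π s : ℕ) = posS s) ∧ (∀ q, (τ q : ℕ) = posQ q) ∧
      ∀ s q, (s, q) ∈ F ↔ ¬ ((s, q) ∈ I.edges ↔ posQ q < J s) := by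
  obtain ⟨π, hπ, hπk⟩ := h.students.exists_perm
  obtain ⟨τ, hτ, hτk⟩ := h.questions.exists_perm
  let F : Finset (Fin I.numS × Fin I.numQ) :=
    Finset.univ.filter fun x => ¬ (x ∈ I.edges ↔ posQ x.2 < J x.1)
  have hF : ∀ s q, (s, q) ∈ F ↔ ¬ ((s, q) ∈ I.edges ↔ posQ q < J s) := by simp [F]
  have hN : ∀ s, nbhd (symmDiff I.edges F) s = {q | (τ q : ℕ) < J s} := by
    intro s
    ext q
    change (s, q) ∈ symmDiff I.edges F ↔ (τ q : ℕ) < J s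
    rw [Finset.mem_symmDiff, hF, hτ]
    tauto
  have hlt : ∀ s, posS s < I.numS := fun s => by rw [← hπ]; exact (π s).2
  refine ⟨F, π, τ, ⟨hπk, hτk, ?_, fun s => ⟨J s, hN s⟩⟩, ?_, hπ, hτ, hF⟩
  · intro s₁ s₂ h12
    rw [hN, hN]
    intro q hq
    have := h.mono s₁ s₂ (by rw [← hπ, ← hπ]; exact h12) (hlt s₁)
    exact lt_of_lt_of_le hq this
  · rw [h.cost, card_eq_sum_rows]
    refine Finset.sum_congr rfl fun s _ => ?_
    rw [if_pos (hlt s)]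
    refine Finset.sum_congr rfl fun q _ => ?_
    have h1 : ((I.β q : ℕ) + I.k < J s ∨ posQ q < J s) ↔ posQ q < J s := by
      have := hτk q
      have := hτ q
      omega
    simp only [hF, h1]
    by_cases h2 : ((s, q) ∈ I.edges ↔ posQ q < J s) <;> simp [h2]

end Partial

/-! ### Reasoning about programs -/

/-- `Runs B P σ Q`: started in `σ`, the program `P` halts without writing a word above `B`, and its
running time and final state satisfy `Q`. -/
def Runs (B : ℕ) (P : Prog) (σ : State) (Q : ℕ → State → Prop) : Prop :=
  ∃ t σ', Exec B P σ t σ' ∧ Q t σ'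

/-- The state after writing `v` to the register `r`. -/
def State.set (σ : State) (r v : ℕ) : State := ⟨Function.update σ.reg r v, σ.mem⟩

/-- The state after writing `v` to the memory cell `a`. -/
def State.write (σ : State) (a v : ℕ) : State := ⟨σ.reg, Function.update σ.mem a v⟩

theorem State.reg_set (σ : State) (r v r' : ℕ) :
    (σ.set r v).reg r' = if r' = r then v else σ.reg r' := Function.update_apply _ _ _ _

theorem State.mem_set (σ : State) (r v : ℕ) : (σ.set r v).mem = σ.mem := rfl

theorem State.reg_write (σ : State) (a v : ℕ) : (σ.write a v).reg = σ.reg := rfl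

theorem State.mem_write (σ : State) (a v a' : ℕ) :
    (σ.write a v).mem a' = if a' = a then v else σ.mem a' := Function.update_apply _ _ _ _

/-- The registers below `n` agree. -/
def Frame (n : ℕ) (σ σ' : State) : Prop := ∀ r < n, σ'.reg r = σ.reg r

theorem Frame.refl (n : ℕ) (σ : State) : Frame n σ σ := fun _ _ => rfl

theorem Frame.trans {n : ℕ} {σ₁ σ₂ σ₃ : State} (h : Frame n σ₁ σ₂) (h' : Frame n σ₂ σ₃) :
    Frame n σ₁ σ₃ := fun r hr => (h' r hr).trans (h r hr)

theorem Frame.mono {n n' : ℕ} {σ σ' : State} (h : Frame n σ σ') (hn : n' ≤ n) : Frame n' σ σ' :=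
  fun r hr => h r (hr.trans_le hn)

theorem frame_set {n r v : ℕ} {σ σ' : State} (hr : n ≤ r) :
    Frame n σ (σ'.set r v) ↔ Frame n σ σ' := by
  unfold Frame
  refine forall₂_congr fun r' hr' => ?_
  rw [State.reg_set, if_neg (by omega)]

theorem frame_set_left {n r v : ℕ} {σ σ' : State} (hr : n ≤ r) :
    Frame n (σ'.set r v) σ ↔ Frame n σ' σ := by
  unfold Frame
  refine forall₂_congr fun r' hr' => ?_
  rw [State.reg_set, if_neg (by omega)]

theorem frame_write {n a v : ℕ} {σ σ' : State} :
    Frame n σ (σ'.write a v) ↔ Frame n σ σ' := Iff.rfl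

section Runs
variable {B : ℕ} {P P₁ P₂ : Prog} {b : Test} {σ : State} {Q Q' : ℕ → State → Prop}

theorem Runs.mono (h : Runs B P σ Q) (hQ : ∀ t σ', Q t σ' → Q' t σ') : Runs B P σ Q' := by
  obtain ⟨t, σ', he, hq⟩ := h
  exact ⟨t, σ', he, hQ _ _ hq⟩

theorem runs_skip : Runs B .skip σ Q ↔ Q 1 σ := by
  constructor
  · rintro ⟨t, σ', he, hq⟩
    cases he
    exact hq
  · exact fun h => ⟨_, _, Exec.skip σ, h⟩

theorem runs_assign {r : ℕ} {e : Rhs} :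
    Runs B (.assign r e) σ Q ↔ e.eval σ ≤ B ∧ Q 1 (σ.set r (e.eval σ)) := by
  constructor
  · rintro ⟨t, σ', he, hq⟩
    cases he with
    | assign _ _ _ hB => exact ⟨hB, hq⟩
  · exact fun h => ⟨_, _, Exec.assign σ r e h.1, h.2⟩

theorem runs_store {a r : ℕ} :
    Runs B (.store a r) σ Q ↔ σ.reg r ≤ B ∧ Q 1 (σ.write (σ.reg a) (σ.reg r)) := by
  constructor
  · rintro ⟨t, σ', he, hq⟩
    cases he with
    | store _ _ _ hB => exact ⟨hB, hq⟩
  · exact fun h => ⟨_, _, Exec.store σ a r h.1, h.2⟩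

theorem runs_seq :
    Runs B (.seq P₁ P₂) σ Q ↔ Runs B P₁ σ fun t₁ σ₁ => Runs B P₂ σ₁ fun t₂ => Q (t₁ + t₂) := by
  constructor
  · rintro ⟨t, σ', he, hq⟩
    cases he with
    | seq h₁ h₂ => exact ⟨_, _, h₁, _, _, h₂, hq⟩
  · rintro ⟨t₁, σ₁, h₁, t₂, σ₂, h₂, hq⟩
    exact ⟨_, _, Exec.seq h₁ h₂, hq⟩

theorem runs_branch :
    Runs B (.branch b P₁ P₂) σ Q ↔ (b.Holds σ → Runs B P₁ σ fun t => Q (1 + t)) ∧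
      (¬ b.Holds σ → Runs B P₂ σ fun t => Q (1 + t)) := by
  constructor
  · rintro ⟨t, σ', he, hq⟩
    cases he with
    | branch_true hb h => exact ⟨fun _ => ⟨_, _, h, hq⟩, fun hn => absurd hb hn⟩
    | branch_false hb h => exact ⟨fun hn => absurd hn hb, fun _ => ⟨_, _, h, hq⟩⟩
  · rintro ⟨h₁, h₂⟩
    by_cases hb : b.Holds σ
    · obtain ⟨t, σ', he, hq⟩ := h₁ hb
      exact ⟨_, _, Exec.branch_true hb he, hq⟩
    · obtain ⟨t, σ', he, hq⟩ := h₂ hb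
      exact ⟨_, _, Exec.branch_false hb he, hq⟩

/-- A loop whose body runs `N` times, with an invariant that counts the iterations. -/
theorem runs_loop (N T : ℕ) (Inv : ℕ → State → Prop) (h₀ : Inv 0 σ)
    (hstep : ∀ y < N, ∀ σ, Inv y σ →
      b.Holds σ ∧ Runs B P σ fun t σ' => t ≤ T ∧ Inv (y + 1) σ')
    (hend : ∀ σ, Inv N σ → ¬ b.Holds σ) :
    Runs B (.loop b P) σ fun t σ' => t ≤ N * (T + 1) + 1 ∧ Inv N σ' := by
  have key : ∀ d y, y + d = N → ∀ σ, Inv y σ →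
      Runs B (.loop b P) σ fun t σ' => t ≤ d * (T + 1) + 1 ∧ Inv N σ' := by
    intro d
    induction d with
    | zero =>
      rintro y rfl σ h
      exact ⟨_, _, Exec.loop_false (hend _ h), by omega, h⟩
    | succ d ih =>
      intro y hy σ h
      obtain ⟨hb, t, σ', he, ht, hinv⟩ := hstep y (by omega) σ h
      obtain ⟨t', σ'', he', ht', hinv'⟩ := ih (y + 1) (by omega) σ' hinv
      refine ⟨_, _, Exec.loop_true hb he he', ?_, hinv'⟩
      rw [Nat.succ_mul]
      omega
  exact key N 0 (by omega) σ h₀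

end Runs

/-! ### Constants in registers and the input in memory -/

-- Sequencing and assignment of programs.
infixr:60 " ;; " => Prog.seq
infix:70 " ≔ " => Prog.assign

-- Names of the registers that hold the constants of an instance; `Consts` gives their contents.
notation "rZero" => 0
notation "rNumS" => 1
notation "rNumQ" => 2
notation "rK" => 3
notation "rWidth" => 4
notation "rMasks" => 5
notation "rOne" => 6
notation "rTwo" => 7
notation "rCap" => 8
notation "rThree" => 9
notation "rOut" => 10
notation "rSize" => 11
notation "rTab" => 12
notation "rStates" => 13
notation "rMoves" => 14
notation "rCols" => 15
notation "rEdges" => 16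
notation "rBeta" => 17
notation "rLen" => 18

/-- The number of positions in a window. -/
def width (I : NearInstance) : ℕ := 2 * I.k + 1

/-- The number of masks of a window. -/
def masks (I : NearInstance) : ℕ := 2 ^ (2 * I.k + 1)

/-- The number of configurations. -/
def states (I : NearInstance) : ℕ := (I.numS + 1) * (I.numQ + 1) * masks I * masks I

/-- The length of the input. -/
def inputSize (I : NearInstance) : ℕ := 3 + I.numS + I.numQ + I.numS * I.numQ

theorem width_lt_masks (I : NearInstance) : width I < masks I := Nat.lt_two_pow_self

/-- The words of the program are estimated through the number of configurations. -/
theorem le_states (I : NearInstance) :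
    4 * (I.numS * I.numQ + I.numS + I.numQ + 1) ≤ states I ∧ masks I ≤ states I ∧
      2 * I.k + 1 < masks I ∧ 2 ≤ masks I := by
  have h1 := width_lt_masks I
  unfold width at h1
  have h2 : 2 ≤ masks I := by omega
  refine ⟨?_, ?_, h1, h2⟩
  · calc 4 * (I.numS * I.numQ + I.numS + I.numQ + 1)
        = (I.numS + 1) * (I.numQ + 1) * 2 * 2 := by ring
      _ ≤ _ := by unfold states; gcongr
  · unfold states
    exact Nat.le_mul_of_pos_left _ (by positivity)

/-- The registers below `20` hold the constants of the instance. -/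
structure Consts (I : NearInstance) (σ : State) : Prop where
  zero : σ.reg rZero = 0
  numS : σ.reg rNumS = I.numS
  numQ : σ.reg rNumQ = I.numQ
  k : σ.reg rK = I.k
  width : σ.reg rWidth = width I
  masks : σ.reg rMasks = masks I
  one : σ.reg rOne = 1
  two : σ.reg rTwo = 2
  cap : σ.reg rCap = cap I
  three : σ.reg rThree = 3
  out : σ.reg rOut = inputSize I
  size : σ.reg rSize = 2 * inputSize I
  tab : σ.reg rTab = 3 * inputSize I
  states : σ.reg rStates = states I
  moves : σ.reg rMoves = 2 * NearEditing.width I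
  cols : σ.reg rCols = I.numQ + 1
  edges : σ.reg rEdges = 3 + I.numS + I.numQ
  beta : σ.reg rBeta = 3 + I.numS
  len : σ.reg rLen = inputSize I - 2

/-- The input is in memory. -/
structure Input (I : NearInstance) (σ : State) : Prop where
  alpha : ∀ s : Fin I.numS, σ.mem (3 + s) = I.α s
  beta : ∀ q : Fin I.numQ, σ.mem (3 + I.numS + q) = I.β q
  edges : ∀ (s : Fin I.numS) (q : Fin I.numQ),
    σ.mem (3 + I.numS + I.numQ + (I.numQ * s + q)) = if (s, q) ∈ I.edges then 1 else 0

theorem Consts.frame {I : NearInstance} {σ σ' : State} (h : Consts I σ) (hf : Frame 20 σ σ') :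
    Consts I σ' := by
  constructor <;> rw [hf _ (by norm_num)]
  exacts [h.zero, h.numS, h.numQ, h.k, h.width, h.masks, h.one, h.two, h.cap, h.three, h.out,
    h.size, h.tab, h.states, h.moves, h.cols, h.edges, h.beta, h.len]

theorem mul_add_lt {m p : ℕ} (s : Fin m) (q : Fin p) : p * s + q < m * p := by
  calc p * (s : ℕ) + q < p * s + p := by have := q.2; omega
    _ = p * (s + 1) := by ring
    _ ≤ p * m := Nat.mul_le_mul_left _ s.2
    _ = m * p := Nat.mul_comm _ _

theorem Input.congr {I : NearInstance} {σ σ' : State} (h : Input I σ)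
    (hm : ∀ a < inputSize I, σ'.mem a = σ.mem a) : Input I σ' := by
  unfold inputSize at hm
  constructor
  · intro s
    rw [hm _ (by omega), h.alpha]
  · intro q
    rw [hm _ (by omega), h.beta]
  · intro s q
    have := mul_add_lt s q
    rw [hm _ (by omega), h.edges]

/-! ### Reading a bit -/

/-- From the exponent in register `61`, the power of two in register `63`. -/
def powProg : Prog :=
  63 ≔ .const 1 ;; 64 ≔ .const 0 ;;
  .loop (.lt 64 61) (63 ≔ .op .add 63 63 ;; 64 ≔ .op .add 64 rOne)

theorem powProg_runs {B : ℕ} {σ : State} {e : ℕ} (h6 : σ.reg rOne = 1) (h61 : σ.reg 61 = e)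
    (hB : 2 ^ e ≤ B) : Runs B powProg σ fun t σ' => t ≤ 3 * e + 3 ∧ σ'.mem = σ.mem ∧
      Frame 63 σ σ' ∧ σ'.reg 63 = 2 ^ e := by
  have heB : e < 2 ^ e := Nat.lt_two_pow_self
  simp only [powProg, runs_seq, runs_assign, Rhs.eval]
  refine ⟨by omega, by omega, ?_⟩
  refine (runs_loop e 2 (fun y σ' => σ'.mem = σ.mem ∧ Frame 63 σ σ' ∧ σ'.reg 63 = 2 ^ y ∧
    σ'.reg 64 = y) ?_ ?_ ?_).mono ?_
  · simp [State.reg_set, State.mem_set, frame_set, Frame.refl]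
  · rintro y hy τ ⟨hmem, hf, h63, h64⟩
    have h61' := hf 61 (by norm_num)
    have h6' := hf rOne (by norm_num)
    have hpow : 2 ^ (y + 1) ≤ 2 ^ e := Nat.pow_le_pow_right (by norm_num) hy
    simp [runs_seq, runs_assign, Rhs.eval, Op.eval, Test.Holds, State.reg_set, State.mem_set,
      frame_set, *]
    omega
  · rintro τ ⟨hmem, hf, h63, h64⟩
    have h61' := hf 61 (by norm_num)
    simp [Test.Holds, *]
  · rintro t τ ⟨ht, hmem, hf, h63, h64⟩
    exact ⟨by omega, hmem, hf, h63⟩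

/-- Register `62` receives the bit of register `60` whose index is in register `61`.  An index
outside the window is not raised to a power of two, as that might overflow. -/
def bitProg : Prog :=
  .branch (.lt 61 rWidth)
    (powProg ;; 62 ≔ .op .div 60 63 ;; 65 ≔ .op .div 62 rTwo ;; 65 ≔ .op .mul 65 rTwo ;;
      62 ≔ .op .sub 62 65)
    (62 ≔ .const 0)

theorem bitProg_runs {I : NearInstance} {B : ℕ} {σ : State} {x e : ℕ} (hB : 20 * states I ≤ B)
    (hc : Consts I σ) (h60 : σ.reg 60 = x) (h61 : σ.reg 61 = e) (hx : x < masks I) :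
    Runs B bitProg σ fun t σ' => t ≤ 3 * width I + 8 ∧ σ'.mem = σ.mem ∧ Frame 62 σ σ' ∧
      σ'.reg 62 = (x.testBit e).toNat ∧ (e < width I → σ'.reg 63 = 2 ^ e) := by
  obtain ⟨hs1, hs2, hs3, hs4⟩ := le_states I
  simp only [bitProg, runs_branch, Test.Holds, h61, hc.width]
  constructor
  · intro he
    have hpow : 2 ^ e ≤ masks I := Nat.pow_le_pow_right (by norm_num) he.le
    refine runs_seq.2 ((powProg_runs hc.one h61 (by omega)).mono ?_)
    rintro t τ ⟨ht, hmem, hf, h63⟩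
    have h7 := (hf rTwo (by norm_num)).trans hc.two
    have h60' := (hf 60 (by norm_num)).trans h60
    have hdiv : x / 2 ^ e ≤ x := Nat.div_le_self _ _
    have hf' : Frame 62 σ τ := hf.mono (by norm_num)
    simp only [runs_seq, runs_assign, Rhs.eval, Op.eval, State.reg_set, State.mem_set, frame_set,
      le_refl, Nat.reduceLeDiff, h7, h60', h63, hmem, hf', Nat.toNat_testBit, if_true, if_false,
      Nat.reduceEqDiff, true_and, implies_true, and_true]
    omega
  · intro he
    have hbit : x.testBit e = false := by
      refine Nat.testBit_lt_two_pow (hx.trans_le (Nat.pow_le_pow_right (by norm_num) ?_))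
      unfold width at he
      omega
    simp [runs_assign, Rhs.eval, State.reg_set, State.mem_set, frame_set, Frame.refl, hbit, he]

/-! ### Finding an element by its initial position -/

/-- Register `46` receives the index of the element at the initial position in register `43`, on the
side whose table has the offset in register `40` and the size in register `39`. -/
def searchProg : Prog :=
  47 ≔ .copy 40 ;; 48 ≔ .op .add 40 39 ;; 46 ≔ .const 0 ;;
  .loop (.lt 47 48)
    (49 ≔ .op .add 47 rThree ;; 49 ≔ .load 49 ;;
      .branch (.eq 49 43) (46 ≔ .copy 47) .skip ;; 47 ≔ .op .add 47 rOne)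

theorem searchProg_runs {I : NearInstance} {B : ℕ} {σ : State} {o sz : ℕ} {γ : Fin sz ≃ Fin sz}
    {y₀ : Fin sz} (hB : 20 * states I ≤ B) (hc : Consts I σ) (h40 : σ.reg 40 = o)
    (h39 : σ.reg 39 = sz) (h43 : σ.reg 43 = γ y₀) (hsz : o + sz ≤ I.numS + I.numQ)
    (hγ : ∀ y : Fin sz, σ.mem (3 + o + y) = γ y) :
    Runs B searchProg σ fun t σ' => t ≤ 6 * sz + 4 ∧ σ'.mem = σ.mem ∧ Frame 46 σ σ' ∧
      σ'.reg 46 = o + y₀ := by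
  obtain ⟨hs1, hs2, hs3, hs4⟩ := le_states I
  simp only [searchProg, runs_seq, runs_assign, Rhs.eval, Op.eval, State.reg_set, h40, h39,
    if_true, if_false, Nat.reduceEqDiff]
  refine ⟨by omega, by omega, by omega, ?_⟩
  refine (runs_loop sz 5 (fun y σ' => σ'.mem = σ.mem ∧ Frame 46 σ σ' ∧ σ'.reg 47 = o + y ∧
    σ'.reg 48 = o + sz ∧ ((y₀ : ℕ) < y → σ'.reg 46 = o + y₀)) ?_ ?_ ?_).mono ?_
  · simp [State.reg_set, State.mem_set, frame_set, Frame.refl]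
  · rintro y hy τ ⟨hmem, hf, h47, h48, h46⟩
    have h43' := (hf 43 (by norm_num)).trans h43
    have h6' := (hf rOne (by norm_num)).trans hc.one
    have h9' := (hf rThree (by norm_num)).trans hc.three
    have hy' := hγ ⟨y, hy⟩
    have hlt := (γ ⟨y, hy⟩).2
    have hadd : o + y + 3 = 3 + o + y := by ring
    have heq : (γ ⟨y, hy⟩ : ℕ) = γ y₀ ↔ y = y₀ := by
      rw [← Fin.ext_iff, γ.injective.eq_iff, Fin.ext_iff]
    simp only at hy'
    simp only [runs_seq, runs_assign, runs_branch, runs_skip, Rhs.eval, Op.eval, Test.Holds,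
      State.reg_set, State.mem_set, frame_set, le_refl, Nat.reduceLeDiff, if_true, if_false,
      Nat.reduceEqDiff, h43', h6', h9', h47, h48, hadd, hmem, hy', heq, hf, true_and]
    refine ⟨by omega, by omega, by omega, ?_, ?_⟩
    · intro h
      refine ⟨by omega, by omega, by omega, fun _ => by omega⟩
    · intro h
      refine ⟨by omega, by omega, fun h1 => h46 (by omega)⟩
  · rintro τ ⟨hmem, hf, h47, h48, h46⟩
    simp [Test.Holds, *]
  · rintro t τ ⟨ht, hmem, hf, h47, h48, h46⟩
    exact ⟨by omega, hmem, hf, h46 y₀.2⟩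

/-! ### The cost of a row -/

/-- One step of a sum over `Fin p` that is computed by a counting loop. -/
theorem sum_lt_succ {p : ℕ} (f : Fin p → ℕ) {y : ℕ} (hy : y < p) :
    (∑ q : Fin p, if (q : ℕ) < y + 1 then f q else 0) =
      (∑ q : Fin p, if (q : ℕ) < y then f q else 0) + f ⟨y, hy⟩ := by
  have : ∀ q : Fin p, (if (q : ℕ) < y + 1 then f q else 0) =
      (if (q : ℕ) < y then f q else 0) + if q = ⟨y, hy⟩ then f q else 0 := by
    intro q
    by_cases h : q = ⟨y, hy⟩
    · simp [h]
    · have h' : (q : ℕ) ≠ y := fun h'' => h (Fin.ext h'')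
      have : (q : ℕ) < y + 1 ↔ (q : ℕ) < y := by omega
      simp [h, this]
  simp only [this, Finset.sum_add_distrib, Finset.sum_ite_eq', Finset.mem_univ, if_true]

/-- Register `50` receives the cost of the row of the student in register `36`, for the question
count in register `25` and the question mask in register `27`. -/
def costProg : Prog :=
  50 ≔ .const 0 ;; 51 ≔ .const 0 ;;
  .loop (.lt 51 rNumQ)
    (52 ≔ .op .add rBeta 51 ;; 52 ≔ .load 52 ;; 52 ≔ .op .add 52 rK ;;
      .branch (.lt 52 25) (62 ≔ .const 1) (61 ≔ .op .sub 52 25 ;; 60 ≔ .copy 27 ;; bitProg) ;;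
      53 ≔ .op .mul rNumQ 36 ;; 53 ≔ .op .add 53 51 ;; 53 ≔ .op .add rEdges 53 ;;
      53 ≔ .load 53 ;; .branch (.eq 53 62) .skip (50 ≔ .op .add 50 rOne) ;;
      51 ≔ .op .add 51 rOne)

theorem rowCost_le {I : NearInstance} (s : Fin I.numS) (j b : ℕ) : rowCost I s j b ≤ I.numQ := by
  unfold rowCost
  refine (Finset.sum_le_card_nsmul _ _ 1 fun q _ => ?_).trans (by simp)
  split_ifs <;> simp

theorem costProg_runs {I : NearInstance} {B : ℕ} {σ : State} {s : Fin I.numS} {j b : ℕ}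
    (hB : 20 * states I ≤ B) (hc : Consts I σ) (hin : Input I σ) (h36 : σ.reg 36 = s)
    (h25 : σ.reg 25 = j) (h27 : σ.reg 27 = b) (hb : b < masks I) :
    Runs B costProg σ fun t σ' => t ≤ I.numQ * (3 * width I + 23) + 3 ∧ σ'.mem = σ.mem ∧
      Frame 50 σ σ' ∧ σ'.reg 50 = rowCost I s j b := by
  obtain ⟨hs1, hs2, hs3, hs4⟩ := le_states I
  simp only [costProg, runs_seq, runs_assign, Rhs.eval]
  refine ⟨by omega, by omega, ?_⟩
  refine (runs_loop I.numQ (3 * width I + 22) (fun y σ' => σ'.mem = σ.mem ∧ Frame 50 σ σ' ∧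
    σ'.reg 51 = y ∧ σ'.reg 50 = ∑ q : Fin I.numQ, if (q : ℕ) < y then
      (if ((s, q) ∈ I.edges ↔ Seen I.k j b (I.β q)) then 0 else 1) else 0) ?_ ?_ ?_).mono ?_
  · simp [State.reg_set, State.mem_set, frame_set, Frame.refl]
  · rintro y hy τ ⟨hmem, hf, h51, h50⟩
    have hcτ := hc.frame (hf.mono (by norm_num))
    have h25' := (hf 25 (by norm_num)).trans h25
    have h27' := (hf 27 (by norm_num)).trans h27
    have h36' := (hf 36 (by norm_num)).trans h36
    have hβ := hin.beta ⟨y, hy⟩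
    have hE := hin.edges s ⟨y, hy⟩
    have hlt := (I.β ⟨y, hy⟩).2
    have hidx := mul_add_lt s ⟨y, hy⟩
    have hpart : (∑ q : Fin I.numQ, if (q : ℕ) < y then
      (if ((s, q) ∈ I.edges ↔ Seen I.k j b (I.β q)) then 0 else 1) else 0) ≤ I.numQ := by
      refine le_trans (Finset.sum_le_sum fun q _ => ?_) (rowCost_le s j b)
      split_ifs <;> simp
    have hsum := sum_lt_succ (fun q : Fin I.numQ =>
      if ((s, q) ∈ I.edges ↔ Seen I.k j b (I.β q)) then 0 else 1) hy
    generalize (∑ q : Fin I.numQ, if (q : ℕ) < y then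
      (if ((s, q) ∈ I.edges ↔ Seen I.k j b (I.β q)) then 0 else 1) else 0) = S at *
    generalize hr : (I.β ⟨y, hy⟩ : ℕ) = r at *
    simp only at hβ hE hidx
    refine ⟨by simp [Test.Holds, *, hcτ.numQ], ?_⟩
    simp only [runs_seq, runs_assign, Rhs.eval, Op.eval, State.reg_set, State.mem_set, if_true,
      if_false, Nat.reduceEqDiff, hcτ.beta, h51, hmem, hβ, hcτ.k]
    refine ⟨by omega, by omega, by omega, ?_⟩
    -- the membership bit of the question is in register `62`
    have hseen : Runs B (.branch (.lt 52 25) (62 ≔ .const 1)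
        (61 ≔ .op .sub 52 25 ;; 60 ≔ .copy 27 ;; bitProg))
        (((τ.set 52 (3 + I.numS + y)).set 52 r).set 52 (r + I.k)) fun t τ' =>
        t ≤ 3 * width I + 11 ∧ τ'.mem = σ.mem ∧ Frame 50 σ τ' ∧ τ'.reg 51 = y ∧ τ'.reg 50 = S ∧
          τ'.reg 62 = if Seen I.k j b r then 1 else 0 := by
      simp only [runs_branch, runs_seq, runs_assign, Rhs.eval, Op.eval, Test.Holds, State.reg_set,
        if_true, if_false, Nat.reduceEqDiff, h25', h27']
      constructor
      · intro hlt'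
        have : Seen I.k j b r := Or.inl hlt'
        simp [State.reg_set, State.mem_set, frame_set, *]
        omega
      · intro hlt'
        refine ⟨by omega, by omega, ?_⟩
        refine (bitProg_runs (x := b) (e := r + I.k - j) hB (hcτ.frame ?_) ?_ ?_ hb).mono ?_
        · simp [frame_set, Frame.refl]
        · simp [State.reg_set]
        · simp [State.reg_set]
        · rintro t τ' ⟨ht, hmem', hf', h62, -⟩
          have h51' := hf' 51 (by norm_num)
          have h50' := hf' 50 (by norm_num)
          have hbit : Seen I.k j b r ↔ b.testBit (r + I.k - j) = true := by
            simp [Seen, hlt']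
          simp only [State.mem_set, State.reg_set, if_false, Nat.reduceEqDiff] at hmem' h51' h50'
          refine ⟨by omega, hmem'.trans hmem, hf.trans ?_, h51'.trans h51, h50'.trans h50, ?_⟩
          · have := hf'.mono (n' := 50) (by norm_num)
            simpa [frame_set_left] using this
          · rw [h62]
            simp only [hbit]
            cases b.testBit (r + I.k - j) <;> rfl
    refine hseen.mono ?_
    rintro t τ' ⟨ht, hmem', hf', h51', h50', h62⟩
    have hcτ' := hc.frame (hf'.mono (by norm_num))
    have h36'' := (hf' 36 (by norm_num)).trans h36
    have hiff : ((if (s, (⟨y, hy⟩ : Fin I.numQ)) ∈ I.edges then 1 else 0) =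
        (if Seen I.k j b r then 1 else 0)) ↔ ((s, (⟨y, hy⟩ : Fin I.numQ)) ∈ I.edges ↔
          Seen I.k j b r) := by
      split_ifs <;> simp_all
    have hle : (if (s, (⟨y, hy⟩ : Fin I.numQ)) ∈ I.edges then 1 else 0) ≤ 1 := by
      split_ifs <;> simp
    simp only [runs_seq, runs_assign, runs_branch, runs_skip, Rhs.eval, Op.eval, Test.Holds,
      State.reg_set, State.mem_set, frame_set, le_refl, Nat.reduceLeDiff, if_true, if_false,
      Nat.reduceEqDiff, hcτ'.numQ, hcτ'.edges, hcτ'.one, h36'', h51', h50', h62, hmem', hE, hiff,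
      hf', hsum, hr, true_and]
    refine ⟨by omega, by omega, by omega, by omega, ?_, ?_⟩
    · intro h
      rw [if_pos h]
      refine ⟨by omega, by omega, by omega⟩
    · intro h
      rw [if_neg h]
      refine ⟨by omega, by omega, by omega⟩
  · rintro τ ⟨hmem, hf, h51, h50⟩
    have hcτ := hc.frame (hf.mono (by norm_num))
    simp [Test.Holds, *, hcτ.numQ]
  · rintro t τ ⟨ht, hmem, hf, h51, h50⟩
    have : 3 * width I + 22 + 1 = 3 * width I + 23 := rfl
    rw [this] at ht
    refine ⟨by omega, hmem, hf, ?_⟩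
    rw [h50]
    exact Finset.sum_congr rfl fun q _ => if_pos q.2

/-! ### Trying a move -/

/-- Tries to place an element of the side with size in register `39`, table offset in register `40`,
count in register `38` and mask in register `41`; register `42` holds the index of the element in
the window.  Register `45` tells whether this is possible, register `46` receives the element and
register `44` the new mask. -/
def tryProg : Prog :=
  45 ≔ .const 0 ;;
  .branch (.lt 38 39)
    (43 ≔ .op .add 38 42 ;;
      .branch (.lt 43 rK) .skip
        (43 ≔ .op .sub 43 rK ;;
          .branch (.lt 43 39)
            (60 ≔ .copy 41 ;; 61 ≔ .copy 42 ;; bitProg ;;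
              .branch (.eq 62 rZero)
                (44 ≔ .op .add 41 63 ;; 44 ≔ .op .div 44 rTwo ;; searchProg ;; 45 ≔ .const 1)
                .skip)
            .skip))
    .skip

theorem tryProg_runs {I : NearInstance} {B : ℕ} {σ : State} {pos o sz msk u : ℕ}
    {γ : Fin sz ≃ Fin sz} (hB : 20 * states I ≤ B) (hc : Consts I σ) (h38 : σ.reg 38 = pos)
    (h39 : σ.reg 39 = sz) (h40 : σ.reg 40 = o) (h41 : σ.reg 41 = msk) (h42 : σ.reg 42 = u)
    (hsz : o + sz ≤ I.numS + I.numQ) (hγ : ∀ y : Fin sz, σ.mem (3 + o + y) = γ y)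
    (hmsk : msk < masks I) (hu : u < width I) :
    Runs B tryProg σ fun t σ' => t ≤ 3 * width I + 6 * sz + 30 ∧ σ'.mem = σ.mem ∧ Frame 43 σ σ' ∧
      ((∃ y : Fin sz, pos < sz ∧ Fits I.k pos msk (γ y) ∧ u = (γ y : ℕ) + I.k - pos ∧
        σ'.reg 46 = o + y ∧ σ'.reg 44 = place I.k pos msk (γ y) ∧ σ'.reg 45 = 1) ∨
      (σ'.reg 45 = 0 ∧ ∀ y : Fin sz, pos < sz → Fits I.k pos msk (γ y) →
        u ≠ (γ y : ℕ) + I.k - pos)) := by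
  obtain ⟨hs1, hs2, hs3, hs4⟩ := le_states I
  have hw := width_lt_masks I
  have hwk : width I = 2 * I.k + 1 := rfl
  simp only [tryProg, runs_seq, runs_assign, runs_branch, runs_skip, Rhs.eval, Op.eval,
    Test.Holds, State.reg_set, State.mem_set, frame_set, Frame.refl, le_refl, Nat.reduceLeDiff,
    if_true, if_false, Nat.reduceEqDiff, h38, h39, h40, h41, h42, hc.k, true_and]
  refine ⟨by omega, ?_, ?_⟩
  swap
  · intro h
    exact ⟨by omega, Or.inr fun y hy => absurd hy h⟩
  intro hpos
  refine ⟨by omega, ?_, ?_⟩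
  · intro h
    refine ⟨by omega, Or.inr fun y _ hy => ?_⟩
    have := hy.1
    omega
  intro hk
  refine ⟨by omega, ?_, ?_⟩
  swap
  · intro h
    refine ⟨by omega, Or.inr fun y _ hy => ?_⟩
    have := hy.1
    omega
  intro hr
  refine ⟨by omega, by omega, ?_⟩
  obtain ⟨y₀, hy₀⟩ := γ.surjective ⟨_, hr⟩
  have hy₀' : (γ y₀ : ℕ) = pos + u - I.k := by rw [hy₀]
  have huy : u = (γ y₀ : ℕ) + I.k - pos := by omega
  refine (bitProg_runs (x := msk) (e := u) hB (hc.frame ?_) ?_ ?_ hmsk).mono ?_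
  · simp [frame_set, Frame.refl]
  · simp [State.reg_set]
  · simp [State.reg_set]
  rintro t τ ⟨ht, hmem, hf, h62, h63⟩
  have h0 := hf rZero (by norm_num)
  have h2 := hf rTwo (by norm_num)
  have g38 := hf 38 (by norm_num)
  have g39 := hf 39 (by norm_num)
  have g40 := hf 40 (by norm_num)
  have g41 := hf 41 (by norm_num)
  have g43 := hf 43 (by norm_num)
  have g45 := hf 45 (by norm_num)
  have hf43 : Frame 43 σ τ := by
    simpa [frame_set_left] using hf.mono (n' := 43) (by norm_num)
  have hcτ := hc.frame (hf43.mono (by norm_num))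
  simp only [State.reg_set, State.mem_set, if_true, if_false, Nat.reduceEqDiff, OfNat.zero_ne_ofNat,
    h38, h39, h40, h41, hc.zero, hc.two] at h0 h2 g38 g39 g40 g41 g43 g45 hmem
  specialize h63 hu
  simp only [h62, h0, h2, g41, h63, Bool.toNat_eq_zero, hmem, hf43, true_and]
  have hpow : 2 ^ u ≤ masks I := Nat.pow_le_pow_right (by norm_num) hu.le
  constructor
  · intro hbit
    refine ⟨by omega, by omega, ?_⟩
    refine (searchProg_runs (y₀ := y₀) (γ := γ) (o := o) (sz := sz) hB (hcτ.frame ?_) ?_ ?_ ?_ hsz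
      ?_).mono ?_
    · simp [frame_set, Frame.refl]
    · simp [State.reg_set, g40]
    · simp [State.reg_set, g39]
    · simp [State.reg_set, g43, hy₀']
    · simp [State.mem_set, hmem, hγ]
    rintro t' τ' ⟨ht', hmem', hf', h46⟩
    have g44 := hf' 44 (by norm_num)
    have hf43' : Frame 43 τ τ' := by
      simpa [frame_set_left] using hf'.mono (n' := 43) (by norm_num)
    simp only [State.reg_set, State.mem_set, if_true, if_false, Nat.reduceEqDiff, hmem]
      at hmem' g44
    simp only [frame_set, Nat.reduceLeDiff, hf43.trans hf43', hmem', g44, h46, true_and]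
    refine ⟨by omega, by omega, Or.inl ⟨y₀, hpos, ⟨by omega, by omega, ?_⟩, huy, rfl, ?_, trivial⟩⟩
    · rw [← huy]; exact hbit
    · rw [place, ← huy]
  · intro hbit
    refine ⟨by omega, Or.inr ⟨g45, fun y _ hy hu' => ?_⟩⟩
    have := hy.2.2
    rw [← hu'] at this
    exact hbit this

/-! ### The code of a configuration -/

/-- Configurations within the bounds of the instance. -/
structure InRange (I : NearInstance) (c : Config) : Prop where
  i : c.i ≤ I.numS
  j : c.j ≤ I.numQ
  a : c.a < masks I
  b : c.b < masks I

/-- The number that stands for a configuration, in mixed radix. -/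
def code (I : NearInstance) (c : Config) : ℕ :=
  ((c.i * (I.numQ + 1) + c.j) * masks I + c.a) * masks I + c.b

theorem mul_add_inj {w x y x' y' : ℕ} (hy : y < w) (hy' : y' < w) (h : x * w + y = x' * w + y') :
    x = x' ∧ y = y' := by
  have h1 : (x * w + y) / w = x := by
    rw [mul_comm, Nat.mul_add_div (by omega), Nat.div_eq_of_lt hy, add_zero]
  have h2 : (x' * w + y') / w = x' := by
    rw [mul_comm, Nat.mul_add_div (by omega), Nat.div_eq_of_lt hy', add_zero]
  have : x = x' := by rw [← h1, h, h2]
  subst this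
  exact ⟨rfl, by omega⟩

section Code
variable {I : NearInstance} {c c' : Config} {u x w : ℕ}

theorem InRange.code_lt (h : InRange I c) : code I c < states I := by
  obtain ⟨hi, hj, ha, hb⟩ := h
  have h1 : c.i * (I.numQ + 1) + c.j + 1 ≤ (I.numS + 1) * (I.numQ + 1) := by nlinarith
  have h2 := Nat.mul_le_mul_right (masks I) h1
  have h3 : (c.i * (I.numQ + 1) + c.j) * masks I + c.a + 1 ≤
    (I.numS + 1) * (I.numQ + 1) * masks I := by rw [Nat.succ_mul] at h2; omega
  have h4 := Nat.mul_le_mul_right (masks I) h3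
  rw [Nat.succ_mul] at h4
  unfold code states
  omega

theorem code_injective (h : InRange I c) (h' : InRange I c') (he : code I c = code I c') :
    c = c' := by
  obtain ⟨i, j, a, b⟩ := c
  obtain ⟨i', j', a', b'⟩ := c'
  obtain ⟨h1, rfl⟩ := mul_add_inj h.b h'.b he
  obtain ⟨h2, h3⟩ := mul_add_inj h.a h'.a h1
  obtain ⟨h4, h5⟩ := mul_add_inj (Nat.lt_succ_of_le h.j) (Nat.lt_succ_of_le h'.j) h2
  simp_all

theorem exists_code {n : ℕ} (hn : n < states I) : ∃ c, InRange I c ∧ code I c = n := by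
  have hM : 0 < masks I := by have := width_lt_masks I; omega
  refine ⟨⟨n / masks I / masks I / (I.numQ + 1), n / masks I / masks I % (I.numQ + 1),
    n / masks I % masks I, n % masks I⟩, ⟨?_, ?_, Nat.mod_lt _ hM, Nat.mod_lt _ hM⟩, ?_⟩
  · refine Nat.lt_succ_iff.1 ?_
    simp only
    rw [Nat.div_div_eq_div_mul, Nat.div_div_eq_div_mul]
    refine Nat.div_lt_of_lt_mul ?_
    unfold states at hn
    refine lt_of_lt_of_eq hn ?_
    simp only [Nat.succ_eq_add_one]
    ring
  · exact Nat.lt_succ_iff.1 (Nat.mod_lt _ (Nat.succ_pos _))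
  · simp only [code, Nat.div_add_mod']

/-- The code increases with every move, which makes a single descending loop fill the table. -/
theorem code_lt_code (h : InRange I c)
    (hlt : c.i * (I.numQ + 1) + c.j < c'.i * (I.numQ + 1) + c'.j) : code I c < code I c' := by
  have h2 := Nat.mul_le_mul_right (masks I) hlt
  have h3 : (c.i * (I.numQ + 1) + c.j) * masks I + c.a + 1 ≤
    (c'.i * (I.numQ + 1) + c'.j) * masks I + c'.a := by
    have := h.a
    rw [Nat.succ_mul] at h2
    omega
  have h4 := Nat.mul_le_mul_right (masks I) h3
  rw [Nat.succ_mul] at h4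
  have := h.b
  unfold code
  omega

theorem Move.inRange (h : Move I c u x w c') (hc : InRange I c) :
    InRange I c' ∧ code I c < code I c' := by
  cases h with
  | student s hi hs =>
    refine ⟨⟨hi, hc.j, place_lt hc.a hs.2.1, hc.b⟩, code_lt_code hc ?_⟩
    simp only [Nat.succ_mul]
    omega
  | question q hj hq =>
    exact ⟨⟨hc.i, hj, hc.a, place_lt hc.b hq.2.1⟩, code_lt_code hc (by simp only; omega)⟩

end Code

/-- From the components in the registers `54` to `57`, the code of a configuration in
register `35`. -/
def codeProg : Prog :=
  35 ≔ .op .mul 54 rCols ;; 35 ≔ .op .add 35 55 ;; 35 ≔ .op .mul 35 rMasks ;;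
  35 ≔ .op .add 35 56 ;; 35 ≔ .op .mul 35 rMasks ;; 35 ≔ .op .add 35 57

theorem codeProg_runs {I : NearInstance} {B : ℕ} {σ : State} {c : Config}
    (hB : 20 * states I ≤ B) (hc : Consts I σ) (hr : InRange I c) (h54 : σ.reg 54 = c.i)
    (h55 : σ.reg 55 = c.j) (h56 : σ.reg 56 = c.a) (h57 : σ.reg 57 = c.b) :
    Runs B codeProg σ fun t σ' => t = 6 ∧ σ' = σ.set 35 (code I c) := by
  have h1 := hr.code_lt
  have h2 : (c.i * (I.numQ + 1) + c.j) * masks I + c.a ≤ code I c := by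
    have := width_lt_masks I
    refine le_trans (Nat.le_mul_of_pos_right _ (by omega)) (Nat.le_add_right _ c.b)
  have h3 : c.i * (I.numQ + 1) + c.j ≤ (c.i * (I.numQ + 1) + c.j) * masks I + c.a := by
    have := width_lt_masks I
    refine le_trans (Nat.le_mul_of_pos_right _ (by omega)) (Nat.le_add_right _ c.a)
  have h4 : ((c.i * (I.numQ + 1) + c.j) * masks I + c.a) * masks I + c.b = code I c := rfl
  simp only [codeProg, runs_seq, runs_assign, Rhs.eval, Op.eval, State.reg_set, if_true, if_false,
    Nat.reduceEqDiff, h54, h55, h56, h57, hc.cols, hc.masks, h4]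
  refine ⟨by omega, by omega, by omega, by omega, by omega, by omega, trivial, ?_⟩
  simp [State.set]

/-- A bound on the running time of `candProg`. -/
def candTime (I : NearInstance) : ℕ :=
  3 * width I + 6 * (I.numS + I.numQ) + I.numQ * (3 * width I + 23) + 70

/-- The table is filled for all configurations with code at least `n`. -/
def Table (I : NearInstance) (σ : State) (n : ℕ) : Prop :=
  ∀ c, InRange I c → n ≤ code I c → σ.mem (3 * inputSize I + code I c) = value I c

theorem Table.congr {I : NearInstance} {σ σ' : State} {n : ℕ} (h : Table I σ n)
    (hm : σ'.mem = σ.mem) : Table I σ' n := by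
  unfold Table
  rw [hm]
  exact h

/-- The registers `24` to `27` hold the configuration `c`. -/
structure Holds (σ : State) (c : Config) : Prop where
  i : σ.reg 24 = c.i
  j : σ.reg 25 = c.j
  a : σ.reg 26 = c.a
  b : σ.reg 27 = c.b

theorem Holds.frame {σ σ' : State} {c : Config} (h : Holds σ c) (hf : Frame 28 σ σ') :
    Holds σ' c := by
  constructor <;> rw [hf _ (by norm_num)]
  exacts [h.i, h.j, h.a, h.b]

/-- What is known after trying the move with index `u` from the configuration `c`. -/
def Tried (I : NearInstance) (c : Config) (u : ℕ) (σ : State) : Prop :=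
  (∃ x w c', Move I c u x w c' ∧ σ.reg 34 = w + value I c' ∧ σ.reg 35 = code I c' ∧
    σ.reg 36 = x) ∨ (σ.reg 34 = cap I ∧ ∀ x w c', ¬ Move I c u x w c')

/-- The completion of a trial: register `34` receives the tabulated value of the configuration whose
code is in register `35`, plus the cost in register `50`. -/
def finishProg : Prog :=
  34 ≔ .op .add rTab 35 ;; 34 ≔ .load 34 ;; 34 ≔ .op .add 34 50

theorem finishProg_runs {I : NearInstance} {B : ℕ} {σ : State} {c : Config} {w n : ℕ}
    (hB : 20 * states I ≤ B) (hc : Consts I σ) (hT : Table I σ n) (hr : InRange I c)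
    (hn : n ≤ code I c) (h35 : σ.reg 35 = code I c) (h50 : σ.reg 50 = w) (hw : w ≤ I.numQ) :
    Runs B finishProg σ fun t σ' => t = 3 ∧ σ'.mem = σ.mem ∧ Frame 34 σ σ' ∧
      σ'.reg 34 = w + value I c ∧ σ'.reg 35 = code I c ∧ σ'.reg 36 = σ.reg 36 := by
  obtain ⟨hs1, hs2, hs3, hs4⟩ := le_states I
  have h1 := hr.code_lt
  have h2 := value_le_cap I c
  have h3 := hT c hr hn
  unfold cap at h2
  have h4 : 3 * inputSize I + code I c ≤ B := by unfold inputSize; omega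
  simp only [finishProg, runs_seq, runs_assign, Rhs.eval, Op.eval, State.reg_set, State.mem_set,
    if_true, if_false, Nat.reduceEqDiff, frame_set, Frame.refl, le_refl, hc.tab, h35, h50, h3]
  refine ⟨by omega, by omega, by omega, trivial, trivial, trivial, by omega, trivial, trivial⟩

/-- Tries to place a student. -/
def studentProg : Prog :=
  38 ≔ .copy 24 ;; 39 ≔ .copy rNumS ;; 40 ≔ .const 0 ;; 41 ≔ .copy 26 ;; 42 ≔ .copy 33 ;;
  tryProg ;;
  .branch (.eq 45 rOne)
    (36 ≔ .copy 46 ;; 54 ≔ .op .add 24 rOne ;; 55 ≔ .copy 25 ;; 56 ≔ .copy 44 ;; 57 ≔ .copy 27 ;;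
      codeProg ;; costProg ;; finishProg)
    (34 ≔ .copy rCap)

/-- Tries to place a question. -/
def questionProg : Prog :=
  38 ≔ .copy 25 ;; 39 ≔ .copy rNumQ ;; 40 ≔ .copy rNumS ;; 41 ≔ .copy 27 ;;
  42 ≔ .op .sub 33 rWidth ;; tryProg ;;
  .branch (.eq 45 rOne)
    (36 ≔ .copy 46 ;; 54 ≔ .copy 24 ;; 55 ≔ .op .add 25 rOne ;; 56 ≔ .copy 26 ;; 57 ≔ .copy 44 ;;
      codeProg ;; 50 ≔ .const 0 ;; finishProg)
    (34 ≔ .copy rCap)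

/-- Tries the move whose index is in register `33`, from the configuration in the registers `24` to
`27`. -/
def candProg : Prog := .branch (.lt 33 rWidth) studentProg questionProg

theorem studentProg_runs {I : NearInstance} {B : ℕ} {σ : State} {c : Config} {u n : ℕ}
    (hB : 20 * states I ≤ B) (hc : Consts I σ) (hin : Input I σ) (hT : Table I σ n)
    (hr : InRange I c) (hn : n ≤ code I c + 1) (hh : Holds σ c) (h33 : σ.reg 33 = u)
    (hu : u < width I) :
    Runs B studentProg σ fun t σ' => t + 1 ≤ candTime I ∧ σ'.mem = σ.mem ∧ Frame 34 σ σ' ∧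
      Tried I c u σ' := by
  obtain ⟨hs1, hs2, hs3, hs4⟩ := le_states I
  have hwm := width_lt_masks I
  obtain ⟨i, j, a, b⟩ := c
  have ha := hr.a
  have hb := hr.b
  have hi := hr.i
  have hj := hr.j
  simp only at ha hb hi hj
  simp only [studentProg, runs_seq, runs_assign, Rhs.eval, State.reg_set, if_true, if_false,
    Nat.reduceEqDiff, hh.i, hh.a, h33, hc.numS]
  refine ⟨by omega, by omega, by omega, by omega, by omega, ?_⟩
  refine (tryProg_runs (γ := I.α) (pos := i) (o := 0) (sz := I.numS) (msk := a) (u := u) hB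
    (hc.frame ?_) ?_ ?_ ?_ ?_ ?_ (by omega) ?_ ha hu).mono ?_
  · simp [frame_set, Frame.refl]
  iterate 5 simp [State.reg_set]
  · simpa [State.mem_set] using hin.alpha
  rintro t τ ⟨ht, hmem, hf, hcase⟩
  have hf' : Frame 38 σ τ := by simpa [frame_set_left] using hf.mono (n' := 38) (by norm_num)
  have hcτ := hc.frame (hf'.mono (by norm_num))
  have hhτ := hh.frame (hf'.mono (by norm_num))
  simp only [State.mem_set] at hmem
  simp only [runs_branch, Test.Holds, hcτ.one]
  unfold candTime
  rcases hcase with ⟨s, hpos, hfit, hus, h46, h44, h45⟩ | ⟨h45, hno⟩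
  · rw [zero_add] at h46
    have hs := s.2
    have hmove := Move.student (I := I) (j := j) (b := b) s hpos hfit
    obtain ⟨hr', hlt⟩ := hmove.inRange hr
    have ha' := hr'.a
    simp only at ha'
    refine ⟨fun _ => ?_, fun h => absurd h45 h⟩
    simp only [runs_seq, runs_assign, Rhs.eval, Op.eval, State.reg_set, if_true, if_false,
      Nat.reduceEqDiff, hhτ.i, hhτ.j, hhτ.b, h44, h46, hcτ.one]
    refine ⟨by omega, by omega, by omega, by omega, by omega, ?_⟩
    refine (codeProg_runs (c := ⟨i + 1, j, place I.k i a (I.α s), b⟩) hB (hcτ.frame ?_) hr'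
      ?_ ?_ ?_ ?_).mono ?_
    · simp [frame_set, Frame.refl]
    iterate 4 simp [State.reg_set]
    rintro t₁ τ₁ ⟨rfl, rfl⟩
    refine (costProg_runs (s := s) (j := j) (b := b) hB (hcτ.frame ?_) (hin.congr ?_) ?_ ?_ ?_
      hb).mono ?_
    · simp [frame_set, Frame.refl]
    · simp [State.mem_set, hmem]
    · simp [State.reg_set]
    · simp [State.reg_set, hhτ.j]
    · simp [State.reg_set, hhτ.b]
    rintro t₂ τ₂ ⟨ht₂, hmem₂, hf₂, h50⟩
    have g35 := hf₂ 35 (by norm_num)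
    have g36 := hf₂ 36 (by norm_num)
    have hf₂' : Frame 34 τ τ₂ := by
      simpa [frame_set_left] using hf₂.mono (n' := 34) (by norm_num)
    have hf₂'' := (hf'.mono (n' := 34) (by norm_num)).trans hf₂'
    simp only [State.mem_set, State.reg_set, if_true, if_false, Nat.reduceEqDiff, hmem]
      at hmem₂ g35 g36
    refine (finishProg_runs hB (hc.frame (hf₂''.mono (by norm_num))) (n := n) ?_ hr'
      (by omega) g35 h50 (rowCost_le _ _ _)).mono ?_
    · exact hT.congr hmem₂
    rintro t₃ τ₃ ⟨rfl, hmem₃, hf₃, h34, h35, h36⟩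
    refine ⟨by omega, hmem₃.trans hmem₂, hf₂''.trans hf₃, Or.inl ⟨_, _, _, ?_, h34, h35,
      h36.trans g36⟩⟩
    rw [hus]
    exact hmove
  · refine ⟨fun h => by omega, fun _ => ?_⟩
    simp only [runs_assign, Rhs.eval, hcτ.cap]
    refine ⟨by unfold cap; omega, by omega, hmem, ?_, Or.inr ⟨by simp [State.reg_set], ?_⟩⟩
    · simpa [frame_set] using hf'.mono (n' := 34) (by norm_num)
    · intro x w c' hm
      generalize hu' : u = u' at hm
      cases hm with
      | student s hi hs => exact hno s hi hs hu'
      | question q hj hq => unfold width at hu; omega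

theorem questionProg_runs {I : NearInstance} {B : ℕ} {σ : State} {c : Config} {u n : ℕ}
    (hB : 20 * states I ≤ B) (hc : Consts I σ) (hin : Input I σ) (hT : Table I σ n)
    (hr : InRange I c) (hn : n ≤ code I c + 1) (hh : Holds σ c) (h33 : σ.reg 33 = u)
    (hu : ¬ u < width I) (hu2 : u < 2 * width I) :
    Runs B questionProg σ fun t σ' => t + 1 ≤ candTime I ∧ σ'.mem = σ.mem ∧ Frame 34 σ σ' ∧
      Tried I c u σ' := by
  obtain ⟨hs1, hs2, hs3, hs4⟩ := le_states I
  have hwm := width_lt_masks I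
  obtain ⟨i, j, a, b⟩ := c
  have ha := hr.a
  have hb := hr.b
  have hi := hr.i
  have hj := hr.j
  simp only at ha hb hi hj
  simp only [questionProg, runs_seq, runs_assign, Rhs.eval, Op.eval, State.reg_set, if_true,
    if_false, Nat.reduceEqDiff, hh.j, hh.b, h33, hc.numS, hc.numQ, hc.width]
  refine ⟨by omega, by omega, by omega, by omega, by omega, ?_⟩
  refine (tryProg_runs (γ := I.β) (pos := j) (o := I.numS) (sz := I.numQ) (msk := b)
    (u := u - width I) hB (hc.frame ?_) ?_ ?_ ?_ ?_ ?_ le_rfl ?_ hb (by omega)).mono ?_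
  · simp [frame_set, Frame.refl]
  iterate 5 simp [State.reg_set]
  · simpa [State.mem_set] using hin.beta
  rintro t τ ⟨ht, hmem, hf, hcase⟩
  have hf' : Frame 38 σ τ := by simpa [frame_set_left] using hf.mono (n' := 38) (by norm_num)
  have hcτ := hc.frame (hf'.mono (by norm_num))
  have hhτ := hh.frame (hf'.mono (by norm_num))
  simp only [State.mem_set] at hmem
  simp only [runs_branch, Test.Holds, hcτ.one]
  unfold candTime
  rcases hcase with ⟨q, hpos, hfit, huq, h46, h44, h45⟩ | ⟨h45, hno⟩
  · have hq := q.2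
    have hmove := Move.question (I := I) (i := i) (a := a) q hpos hfit
    obtain ⟨hr', hlt⟩ := hmove.inRange hr
    have hb' := hr'.b
    simp only at hb'
    refine ⟨fun _ => ?_, fun h => absurd h45 h⟩
    simp only [runs_seq, runs_assign, Rhs.eval, Op.eval, State.reg_set, if_true, if_false,
      Nat.reduceEqDiff, hhτ.i, hhτ.j, hhτ.a, h44, h46, hcτ.one]
    refine ⟨by omega, by omega, by omega, by omega, by omega, ?_⟩
    refine (codeProg_runs (c := ⟨i, j + 1, a, place I.k j b (I.β q)⟩) hB (hcτ.frame ?_) hr'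
      ?_ ?_ ?_ ?_).mono ?_
    · simp [frame_set, Frame.refl]
    iterate 4 simp [State.reg_set]
    rintro t₁ τ₁ ⟨rfl, rfl⟩
    refine ⟨by omega, ?_⟩
    refine (finishProg_runs (w := 0) hB (hcτ.frame ?_) (n := n) ?_ hr'
      (by omega) ?_ ?_ (by omega)).mono ?_
    · simp [frame_set, Frame.refl]
    · exact hT.congr hmem
    · simp [State.reg_set]
    · simp [State.reg_set]
    rintro t₃ τ₃ ⟨rfl, hmem₃, hf₃, h34, h35, h36⟩
    simp only [State.mem_set, State.reg_set, if_true, if_false, Nat.reduceEqDiff, hmem]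
      at hmem₃ h36
    have hf₃' : Frame 34 τ τ₃ := by simpa [frame_set_left] using hf₃
    refine ⟨by omega, hmem₃, (hf'.mono (by norm_num)).trans hf₃', Or.inl ⟨_, _, _, ?_, h34, h35,
      h36⟩⟩
    have : u = 2 * I.k + 1 + ((I.β q : ℕ) + I.k - j) := by unfold width at *; omega
    rw [this]
    exact hmove
  · refine ⟨fun h => by omega, fun _ => ?_⟩
    simp only [runs_assign, Rhs.eval, hcτ.cap]
    refine ⟨by unfold cap; omega, by omega, hmem, ?_, Or.inr ⟨by simp [State.reg_set], ?_⟩⟩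
    · simpa [frame_set] using hf'.mono (n' := 34) (by norm_num)
    · intro x w c' hm
      generalize hu' : u = u' at hm
      cases hm with
      | student s hi hs =>
        have := hs.2.1
        unfold width at hu
        omega
      | question q hj hq => exact hno q hj hq (by unfold width; omega)

theorem candProg_runs {I : NearInstance} {B : ℕ} {σ : State} {c : Config} {u n : ℕ}
    (hB : 20 * states I ≤ B) (hc : Consts I σ) (hin : Input I σ) (hT : Table I σ n)
    (hr : InRange I c) (hn : n ≤ code I c + 1) (hh : Holds σ c) (h33 : σ.reg 33 = u)
    (hu : u < 2 * width I) :
    Runs B candProg σ fun t σ' => t ≤ candTime I ∧ σ'.mem = σ.mem ∧ Frame 34 σ σ' ∧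
      Tried I c u σ' := by
  simp only [candProg, runs_branch, Test.Holds, h33, hc.width]
  refine ⟨fun h => (studentProg_runs hB hc hin hT hr hn hh h33 h).mono ?_,
    fun h => (questionProg_runs hB hc hin hT hr hn hh h33 h hu).mono ?_⟩ <;>
  · rintro t σ' ⟨ht, h'⟩
    exact ⟨by omega, h'⟩

/-! ### The best move -/

/-- From the code in register `20`, the components of the configuration in the registers `24` to
`27`. -/
def decodeProg : Prog :=
  28 ≔ .op .div 20 rMasks ;; 29 ≔ .op .mul 28 rMasks ;; 27 ≔ .op .sub 20 29 ;;
  29 ≔ .op .div 28 rMasks ;; 30 ≔ .op .mul 29 rMasks ;; 26 ≔ .op .sub 28 30 ;;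
  24 ≔ .op .div 29 rCols ;; 28 ≔ .op .mul 24 rCols ;; 25 ≔ .op .sub 29 28

theorem decodeProg_runs {I : NearInstance} {B : ℕ} {σ : State} {c : Config}
    (hB : 20 * states I ≤ B) (hc : Consts I σ) (hr : InRange I c) (h20 : σ.reg 20 = code I c) :
    Runs B decodeProg σ fun t σ' => t = 9 ∧ σ'.mem = σ.mem ∧ Frame 24 σ σ' ∧ Holds σ' c := by
  have hlt := hr.code_lt
  have hM := width_lt_masks I
  have hi : c.i ≤ states I := by have := hr.i; have := (le_states I).1; omega
  have e1 : code I c / masks I = (c.i * (I.numQ + 1) + c.j) * masks I + c.a := by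
    rw [code, mul_comm, Nat.mul_add_div (by omega), Nat.div_eq_of_lt hr.b, add_zero]
  have e2 : ((c.i * (I.numQ + 1) + c.j) * masks I + c.a) / masks I =
      c.i * (I.numQ + 1) + c.j := by
    rw [mul_comm, Nat.mul_add_div (by omega), Nat.div_eq_of_lt hr.a, add_zero]
  have e3 : (c.i * (I.numQ + 1) + c.j) / (I.numQ + 1) = c.i := by
    rw [mul_comm, Nat.mul_add_div (by omega), Nat.div_eq_of_lt (Nat.lt_succ_of_le hr.j), add_zero]
  have e4 : code I c = ((c.i * (I.numQ + 1) + c.j) * masks I + c.a) * masks I + c.b := rfl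
  have l1 : code I c / masks I ≤ code I c := Nat.div_le_self _ _
  have l2 := Nat.div_le_self ((c.i * (I.numQ + 1) + c.j) * masks I + c.a) (masks I)
  rw [e1] at l1
  rw [e2] at l2
  simp only [decodeProg, runs_seq, runs_assign, Rhs.eval, Op.eval, State.reg_set, State.mem_set,
    if_true, if_false, Nat.reduceEqDiff, h20, hc.masks, hc.cols, e1, e2, e3]
  refine ⟨by omega, by omega, by omega, by omega, by omega, by omega, by omega, by omega, by omega,
    trivial, trivial, by simp [frame_set, Frame.refl], ?_⟩
  constructor <;> simp only [State.reg_set, if_true, if_false, Nat.reduceEqDiff] <;> omega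

/-- Register `30` receives the value of the configuration whose code is in register `20`, and
register `31` the index of an optimal move. -/
def bestProg : Prog :=
  decodeProg ;; 30 ≔ .copy rCap ;;
  .branch (.eq 24 rNumS) (.branch (.eq 25 rNumQ) (30 ≔ .const 0) .skip) .skip ;;
  31 ≔ .const 0 ;; 32 ≔ .const 0 ;;
  .loop (.lt 32 rMoves)
    (33 ≔ .copy 32 ;; candProg ;; .branch (.lt 34 30) (30 ≔ .copy 34 ;; 31 ≔ .copy 32) .skip ;;
      32 ≔ .op .add 32 rOne)

/-- A bound on the running time of `bestProg`. -/
def bestTime (I : NearInstance) : ℕ := 2 * width I * (candTime I + 6) + 20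

/-- The value of a configuration before any move is taken into account. -/
def baseValue (I : NearInstance) (c : Config) : ℕ :=
  if c.i = I.numS ∧ c.j = I.numQ then 0 else cap I

theorem value_le_baseValue (I : NearInstance) (c : Config) : value I c ≤ baseValue I c := by
  unfold baseValue
  split_ifs with h
  · obtain ⟨i, j, a, b⟩ := c
    obtain ⟨rfl, rfl⟩ := h
    rw [value_done]
  · exact value_le_cap I c

/-- `v` is the best value among the base value and the moves with index below `y`, and `u` is the
index of a move that attains it, unless it is the base value. -/
structure Best (I : NearInstance) (c : Config) (y u v : ℕ) : Prop where
  le_base : v ≤ baseValue I c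
  le_move : ∀ u' < y, ∀ x w c', Move I c u' x w c' → v ≤ w + value I c'
  le : value I c ≤ v
  attained : v = baseValue I c ∨ ∃ x w c', Move I c u x w c' ∧ v = w + value I c'

section Best
variable {I : NearInstance} {c : Config} {y u v : ℕ}

theorem Best.zero (I : NearInstance) (c : Config) : Best I c 0 0 (baseValue I c) :=
  ⟨le_rfl, by simp, value_le_baseValue I c, Or.inl rfl⟩

/-- After all moves have been tried, the minimum is the value. -/
theorem Best.eq_value (h : Best I c (2 * width I) u v) : v = value I c := by
  refine le_antisymm ?_ h.le
  have h1 := h.le_base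
  unfold baseValue at h1
  by_cases hd : c.i = I.numS ∧ c.j = I.numQ
  · rw [if_pos hd] at h1
    omega
  · rw [if_neg hd] at h1
    by_cases hv : value I c < cap I
    · obtain ⟨u', x, w, c', hm, he⟩ := exists_move_of_value_lt hv (by tauto)
      rw [he]
      exact h.le_move u' hm.index_lt x w c' hm
    · omega

theorem Best.exists_move (h : Best I c (2 * width I) u v) (hv : value I c < cap I)
    (hd : c.i ≠ I.numS ∨ c.j ≠ I.numQ) :
    ∃ x w c', Move I c u x w c' ∧ value I c = w + value I c' := by
  have he := h.eq_value
  rcases h.attained with h1 | ⟨x, w, c', hm, h1⟩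
  · unfold baseValue at h1
    rw [if_neg (by tauto)] at h1
    omega
  · exact ⟨x, w, c', hm, by omega⟩

theorem Best.keep (h : Best I c y u v) {v' : ℕ} (hle : v ≤ v')
    (hv' : (∃ x w c', Move I c y x w c' ∧ v' = w + value I c') ∨
      ∀ x w c', ¬ Move I c y x w c') : Best I c (y + 1) u v := by
  refine ⟨h.le_base, fun u' hu' x w c' hm => ?_, h.le, h.attained⟩
  rcases Nat.lt_succ_iff_lt_or_eq.1 hu' with h1 | rfl
  · exact h.le_move u' h1 x w c' hm
  · rcases hv' with ⟨x', w', c'', hm', he⟩ | hno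
    · obtain ⟨rfl, rfl, rfl⟩ := hm'.unique hm
      omega
    · exact absurd hm (hno _ _ _)

theorem Best.improve (h : Best I c y u v) {v' x w : ℕ} {c' : Config} (hlt : v' < v)
    (hm : Move I c y x w c') (hv' : v' = w + value I c') : Best I c (y + 1) y v' := by
  refine ⟨hlt.le.trans h.le_base, fun u' hu' x' w' c'' hm' => ?_, ?_, Or.inr ⟨_, _, _, hm, hv'⟩⟩
  · rcases Nat.lt_succ_iff_lt_or_eq.1 hu' with h1 | rfl
    · exact hlt.le.trans (h.le_move u' h1 x' w' c'' hm')
    · obtain ⟨rfl, rfl, rfl⟩ := hm.unique hm'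
      omega
  · rw [hv']
    exact hm.value_le

end Best

theorem bestProg_runs {I : NearInstance} {B : ℕ} {σ : State} {c : Config} {n : ℕ}
    (hB : 20 * states I ≤ B) (hc : Consts I σ) (hin : Input I σ) (hT : Table I σ n)
    (hr : InRange I c) (hn : n ≤ code I c + 1) (h20 : σ.reg 20 = code I c) :
    Runs B bestProg σ fun t σ' => t ≤ bestTime I ∧ σ'.mem = σ.mem ∧ Frame 24 σ σ' ∧ Holds σ' c ∧
      σ'.reg 30 = value I c ∧ Best I c (2 * width I) (σ'.reg 31) (value I c) := by
  obtain ⟨hs1, hs2, hs3, hs4⟩ := le_states I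
  have hwm := width_lt_masks I
  have hcap : cap I ≤ B := by unfold cap; omega
  have hbase : baseValue I c ≤ cap I := by unfold baseValue; split_ifs <;> omega
  refine runs_seq.2 ((decodeProg_runs hB hc hr h20).mono ?_)
  rintro t₀ τ₀ ⟨rfl, hmem₀, hf₀, hh₀⟩
  have hc₀ := hc.frame (hf₀.mono (by norm_num))
  -- the registers `30` to `32` are initialised
  have hinit : Runs B (.branch (.eq 24 rNumS) (.branch (.eq 25 rNumQ) (30 ≔ .const 0) .skip) .skip)
      (τ₀.set 30 (cap I)) fun t τ => t ≤ 3 ∧ τ.mem = σ.mem ∧ Frame 24 σ τ ∧ Holds τ c ∧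
        τ.reg 30 = baseValue I c := by
    simp only [runs_branch, runs_assign, runs_skip, Rhs.eval, Test.Holds, State.reg_set,
      State.mem_set, if_true, if_false, Nat.reduceEqDiff, hh₀.i, hh₀.j, hc₀.numS, hc₀.numQ, hmem₀,
      frame_set, Nat.reduceLeDiff, hf₀, true_and]
    have hh : ∀ v, Holds (τ₀.set 30 v) c := fun v => hh₀.frame (by simp [frame_set, Frame.refl])
    have hh' : ∀ v v', Holds ((τ₀.set 30 v).set 30 v') c :=
      fun v v' => hh₀.frame (by simp [frame_set, Frame.refl])
    refine ⟨fun h1 => ⟨fun h2 => ?_, fun h2 => ?_⟩, fun h1 => ?_⟩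
    · simp [baseValue, h1, h2, hh']
    · simp [baseValue, h1, h2, hh]
    · simp [baseValue, h1, hh]
  simp only [runs_seq (P₁ := 30 ≔ _), runs_assign, Rhs.eval, hc₀.cap]
  refine ⟨hcap, runs_seq.2 (hinit.mono ?_)⟩
  rintro t₁ τ₁ ⟨ht₁, hmem₁, hf₁, hh₁, h30⟩
  simp only [runs_seq (P₁ := 31 ≔ _), runs_seq (P₁ := 32 ≔ _), runs_assign, Rhs.eval]
  refine ⟨by omega, by omega, ?_⟩
  refine (runs_loop (2 * width I) (candTime I + 5) (fun y σ' => σ'.mem = σ.mem ∧ Frame 24 σ σ' ∧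
    Holds σ' c ∧ σ'.reg 32 = y ∧ σ'.reg 30 ≤ cap I ∧ Best I c y (σ'.reg 31) (σ'.reg 30))
    ?_ ?_ ?_).mono ?_
  · refine ⟨hmem₁, by simpa [frame_set] using hf₁, hh₁.frame (by simp [frame_set, Frame.refl]),
      by simp [State.reg_set], by simpa [State.reg_set, h30] using hbase, ?_⟩
    simpa [State.reg_set, h30] using Best.zero I c
  · rintro y hy τ ⟨hmem, hf, hh, h32, h30', hbest⟩
    have hcτ := hc.frame (hf.mono (by norm_num))
    refine ⟨by simp [Test.Holds, h32, hcτ.moves, hy], ?_⟩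
    simp only [runs_seq (P₁ := 33 ≔ _), runs_assign, Rhs.eval, h32]
    refine ⟨by omega, runs_seq.2 ((candProg_runs (c := c) (u := y) (n := n) hB
      (hcτ.frame ?_) (hin.congr ?_) (hT.congr ?_) hr hn (hh.frame ?_) ?_ hy).mono ?_)⟩
    · simp [frame_set, Frame.refl]
    · simp [State.mem_set, hmem]
    · simp [State.mem_set, hmem]
    · simp [frame_set, Frame.refl]
    · simp [State.reg_set]
    rintro t₂ τ₂ ⟨ht₂, hmem₂, hf₂, htried⟩
    have g30 := hf₂ 30 (by norm_num)
    have g31 := hf₂ 31 (by norm_num)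
    have g32 := hf₂ 32 (by norm_num)
    have gone := hf₂ rOne (by norm_num)
    have hf₂' : Frame 28 τ τ₂ := by
      simpa [frame_set_left] using hf₂.mono (n' := 28) (by norm_num)
    have hf₂'' := hf.trans (hf₂'.mono (by norm_num))
    have hh₂ := hh.frame hf₂'
    simp only [State.mem_set, State.reg_set, if_true, if_false, Nat.reduceEqDiff, hmem, h32,
      hcτ.one, OfNat.one_ne_ofNat] at hmem₂ g30 g31 g32 gone
    have hcase : (∃ x w c', Move I c y x w c' ∧ τ₂.reg 34 = w + value I c') ∨
        ∀ x w c', ¬ Move I c y x w c' := by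
      rcases htried with ⟨x, w, c', hm, h34, -⟩ | ⟨-, hno⟩
      · exact Or.inl ⟨x, w, c', hm, h34⟩
      · exact Or.inr hno
    have hcap34 : τ₂.reg 34 = cap I ∨ ∃ x w c', Move I c y x w c' ∧ τ₂.reg 34 = w + value I c' := by
      rcases htried with ⟨x, w, c', hm, h34, -⟩ | ⟨h34, -⟩
      · exact Or.inr ⟨x, w, c', hm, h34⟩
      · exact Or.inl h34
    simp only [runs_seq, runs_branch, runs_assign, runs_skip, Rhs.eval, Op.eval, Test.Holds,
      State.reg_set, State.mem_set, if_true, if_false, Nat.reduceEqDiff, g30, g31, g32, gone, hmem₂,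
      OfNat.one_ne_ofNat, frame_set, Nat.reduceLeDiff, hf₂'', true_and]
    constructor
    · intro hlt
      refine ⟨by omega, by omega, by omega, by omega, hh₂.frame (by simp [frame_set, Frame.refl]),
        by omega, ?_⟩
      rcases hcap34 with h | ⟨x, w, c', hm, h34⟩
      · omega
      · exact hbest.improve hlt hm h34
    · intro hlt
      exact ⟨by omega, by omega, hh₂.frame (by simp [frame_set, Frame.refl]),
        h30', hbest.keep (not_lt.1 hlt) hcase⟩
  · rintro τ ⟨hmem, hf, hh, h32, h30', hbest⟩
    have hcτ := hc.frame (hf.mono (by norm_num))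
    simp [Test.Holds, h32, hcτ.moves]
  · rintro t τ ⟨ht, hmem, hf, hh, h32, h30', hbest⟩
    have he := hbest.eq_value
    rw [he] at hbest
    have : candTime I + 5 + 1 = candTime I + 6 := rfl
    rw [this] at ht
    refine ⟨?_, hmem, hf, hh, he, hbest⟩
    unfold bestTime
    omega

/-! ### The table of values -/

/-- Fills the table of values, in descending order of the codes. -/
def tableProg : Prog :=
  20 ≔ .copy rStates ;;
  .loop (.lt rZero 20) (20 ≔ .op .sub 20 rOne ;; bestProg ;; 21 ≔ .op .add rTab 20 ;; .store 21 30)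

theorem tableProg_runs {I : NearInstance} {B : ℕ} {σ : State} (hB : 20 * states I ≤ B)
    (hc : Consts I σ) (hin : Input I σ) :
    Runs B tableProg σ fun t σ' => t ≤ states I * (bestTime I + 4) + 2 ∧ Consts I σ' ∧ Input I σ' ∧
      Table I σ' 0 := by
  obtain ⟨hs1, hs2, hs3, hs4⟩ := le_states I
  simp only [tableProg, runs_seq (P₁ := 20 ≔ .copy _), runs_assign, Rhs.eval, hc.states]
  refine ⟨by omega, ?_⟩
  refine (runs_loop (states I) (bestTime I + 3) (fun y σ' => Consts I σ' ∧ Input I σ' ∧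
    Table I σ' (states I - y) ∧ σ'.reg 20 = states I - y) ?_ ?_ ?_).mono ?_
  · refine ⟨hc.frame (by simp [frame_set, Frame.refl]), hin.congr (by simp [State.mem_set]), ?_,
      by simp [State.reg_set]⟩
    intro c hr hn
    have := hr.code_lt
    omega
  · rintro y hy τ ⟨hcτ, hinτ, hT, h20⟩
    refine ⟨by simp [Test.Holds, hcτ.zero, h20, hy], ?_⟩
    obtain ⟨c, hr, hcode⟩ := exists_code (I := I) (n := states I - (y + 1)) (by omega)
    have hlt := hr.code_lt
    simp only [runs_seq (P₁ := 20 ≔ _), runs_assign, Rhs.eval, Op.eval, h20, hcτ.one]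
    refine ⟨by omega, runs_seq.2 ((bestProg_runs (c := c) hB (hcτ.frame ?_) (hinτ.congr ?_)
      (hT.congr ?_) hr (by omega) ?_).mono ?_)⟩
    · simp [frame_set, Frame.refl]
    · simp [State.mem_set]
    · simp [State.mem_set]
    · simp only [State.reg_set, if_true]
      omega
    rintro t τ₁ ⟨ht, hmem, hf, hh, h30, -⟩
    have g20 := hf 20 (by norm_num)
    simp only [State.reg_set, State.mem_set, if_true] at g20 hmem
    have hfτ : Frame 20 τ τ₁ := by simpa [frame_set_left] using hf.mono (n' := 20) (by norm_num)
    have hc₁ := hcτ.frame hfτ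
    have hcap := value_le_cap I c
    unfold cap at hcap
    have e20 : τ₁.reg 20 = code I c := by omega
    simp only [runs_seq, runs_assign, runs_store, Rhs.eval, Op.eval, State.reg_set, if_true,
      if_false, Nat.reduceEqDiff, hc₁.tab, e20, h30, State.reg_write]
    refine ⟨by unfold inputSize; omega, by omega, by omega, hc₁.frame ?_, hinτ.congr ?_, ?_,
      by omega⟩
    · simp [frame_set, frame_write, Frame.refl]
    · intro a ha
      rw [State.mem_write, if_neg (by omega), State.mem_set, hmem]
    · intro c' hr' hn'
      rw [State.mem_write]
      split_ifs with h
      · rw [code_injective hr' hr (by omega)]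
      · rw [State.mem_set, hmem]
        exact hT c' hr' (by omega)
  · rintro τ ⟨hcτ, hinτ, hT, h20⟩
    simp [Test.Holds, hcτ.zero, h20]
  · rintro t τ ⟨ht, hcτ, hinτ, hT, h20⟩
    have : bestTime I + 3 + 1 = bestTime I + 4 := rfl
    rw [this] at ht
    rw [Nat.sub_self] at hT
    exact ⟨by omega, hcτ, hinτ, hT⟩

/-! ### Following optimal moves -/

/-- Follows optimal moves from the start and records the new positions of all elements, and the
number of questions placed before each student. -/
def traceProg : Prog :=
  22 ≔ .const 0 ;; 20 ≔ .const 0 ;; 23 ≔ .op .add rNumS rNumQ ;;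
  .loop (.lt 22 23)
    (bestProg ;; 33 ≔ .copy 31 ;; candProg ;;
      37 ≔ .op .add rOut 36 ;; 37 ≔ .op .add 37 rOne ;;
      .branch (.lt 33 rWidth) (.store 37 24 ;; 37 ≔ .op .add rSize 36 ;; .store 37 25)
        (.store 37 25) ;;
      20 ≔ .copy 35 ;; 22 ≔ .op .add 22 rOne)

/-- The placed elements of a partial solution are recorded in memory. -/
structure Recorded (I : NearInstance) (c : Config) (posS J : Fin I.numS → ℕ)
    (posQ : Fin I.numQ → ℕ) (σ : State) : Prop where
  student : ∀ s, posS s < c.i → σ.mem (inputSize I + 1 + s) = posS s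
  size : ∀ s, posS s < c.i → σ.mem (2 * inputSize I + s) = J s
  question : ∀ q, posQ q < c.j → σ.mem (inputSize I + 1 + I.numS + q) = posQ q

/-- A partial solution that extends to an optimal one has been recorded up to the configuration `c`,
which lies at step `y`. -/
def Traced (I : NearInstance) (y : ℕ) (c : Config) (σ : State) : Prop :=
  ∃ g posS J posQ, Partial I c g posS J posQ ∧ g + value I c = value I ⟨0, 0, 0, 0⟩ ∧
    Recorded I c posS J posQ σ ∧ InRange I c ∧ c.i + c.j = y

theorem code_start (I : NearInstance) : code I ⟨0, 0, 0, 0⟩ = 0 := by simp [code]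

theorem inRange_start (I : NearInstance) : InRange I ⟨0, 0, 0, 0⟩ := by
  have := width_lt_masks I
  exact ⟨Nat.zero_le _, Nat.zero_le _, by simp only; omega, by simp only; omega⟩

theorem Traced.zero (I : NearInstance) (σ : State) : Traced I 0 ⟨0, 0, 0, 0⟩ σ :=
  ⟨0, _, fun _ => 0, _, Partial.zero I _, by rw [zero_add],
    ⟨by simp, by simp, by simp⟩, inRange_start I, rfl⟩

theorem Traced.value_lt_cap {I : NearInstance} {y : ℕ} {c : Config} {σ : State}
    (h : Traced I y c σ) : value I c < cap I := by
  obtain ⟨g, posS, J, posQ, -, hg, -⟩ := h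
  have := value_start_lt_cap I
  omega

/-- Placing a student optimally and recording it keeps the trace optimal. -/
theorem Traced.student {I : NearInstance} {y i j a b : ℕ} {σ σ' : State} {s : Fin I.numS}
    (h : Traced I y ⟨i, j, a, b⟩ σ) (hi : i < I.numS) (hs : Fits I.k i a (I.α s))
    (hv : value I ⟨i, j, a, b⟩ =
      rowCost I s j b + value I ⟨i + 1, j, place I.k i a (I.α s), b⟩)
    (hm : ∀ x, σ'.mem x = if x = 2 * inputSize I + s then j else
      if x = inputSize I + 1 + s then i else σ.mem x) :
    Traced I (y + 1) ⟨i + 1, j, place I.k i a (I.α s), b⟩ σ' := by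
  obtain ⟨g, posS, J, posQ, hp, hg, hrec, hr, hy⟩ := h
  simp only at hy
  have hsz : inputSize I = 3 + I.numS + I.numQ + I.numS * I.numQ := rfl
  refine ⟨_, _, _, _, hp.student s hi hs, by simp only; omega, ⟨?_, ?_, ?_⟩,
    ((Move.student (b := b) s hi hs).inRange hr).1, by simp only; omega⟩
  · intro s' hs'
    rw [hm, if_neg (by omega)]
    by_cases e : s' = s
    · simp [e]
    · have h1 : (s' : ℕ) ≠ s := fun h => e (Fin.ext h)
      have h2 := hp.students.unplaced s'
      simp only [Function.update_of_ne e] at *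
      rw [if_neg (by omega), hrec.student s' (by simp only; omega)]
  · intro s' hs'
    rw [hm]
    by_cases e : s' = s
    · simp [e]
    · have h1 : (s' : ℕ) ≠ s := fun h => e (Fin.ext h)
      have h2 := hp.students.unplaced s'
      simp only [Function.update_of_ne e] at *
      rw [if_neg (by omega), if_neg (by omega), hrec.size s' (by simp only; omega)]
  · intro q hq
    rw [hm, if_neg (by omega), if_neg (by omega), hrec.question q hq]

/-- Placing a question optimally and recording it keeps the trace optimal. -/
theorem Traced.question {I : NearInstance} {y i j a b : ℕ} {σ σ' : State} {q : Fin I.numQ}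
    (h : Traced I y ⟨i, j, a, b⟩ σ) (hj : j < I.numQ) (hq : Fits I.k j b (I.β q))
    (hv : value I ⟨i, j, a, b⟩ = 0 + value I ⟨i, j + 1, a, place I.k j b (I.β q)⟩)
    (hm : ∀ x, σ'.mem x = if x = inputSize I + 1 + I.numS + q then j else σ.mem x) :
    Traced I (y + 1) ⟨i, j + 1, a, place I.k j b (I.β q)⟩ σ' := by
  obtain ⟨g, posS, J, posQ, hp, hg, hrec, hr, hy⟩ := h
  simp only at hy
  have hsz : inputSize I = 3 + I.numS + I.numQ + I.numS * I.numQ := rfl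
  refine ⟨_, _, _, _, hp.question q hj hq, by omega, ⟨?_, ?_, ?_⟩,
    ((Move.question (a := a) q hj hq).inRange hr).1, by simp only; omega⟩
  · intro s hs
    rw [hm, if_neg (by omega), hrec.student s hs]
  · intro s hs
    rw [hm, if_neg (by omega), hrec.size s hs]
  · intro q' hq'
    rw [hm]
    by_cases e : q' = q
    · simp [e]
    · have h1 : (q' : ℕ) ≠ q := fun h => e (Fin.ext h)
      have h2 := hp.questions.unplaced q'
      simp only [Function.update_of_ne e] at *
      rw [if_neg (by omega), hrec.question q' (by simp only; omega)]

/-- A bound on the running time of `traceProg`. -/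
def traceTime (I : NearInstance) : ℕ :=
  (I.numS + I.numQ) * (bestTime I + candTime I + 11) + 4

theorem traceProg_runs {I : NearInstance} {B : ℕ} {σ : State} (hB : 20 * states I ≤ B)
    (hc : Consts I σ) (hin : Input I σ) (hT : Table I σ 0) :
    Runs B traceProg σ fun t σ' => t ≤ traceTime I ∧ Consts I σ' ∧ Input I σ' ∧ Table I σ' 0 ∧
      ∃ c, Traced I (I.numS + I.numQ) c σ' := by
  obtain ⟨hs1, hs2, hs3, hs4⟩ := le_states I
  have hsz : inputSize I = 3 + I.numS + I.numQ + I.numS * I.numQ := rfl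
  simp only [traceProg, runs_seq (P₁ := 22 ≔ .const _), runs_seq (P₁ := 20 ≔ .const _),
    runs_seq (P₁ := 23 ≔ _), runs_assign, Rhs.eval, Op.eval, State.reg_set, if_false,
    Nat.reduceEqDiff, OfNat.one_ne_ofNat, hc.numS, hc.numQ]
  refine ⟨by omega, by omega, by omega, ?_⟩
  refine (runs_loop (I.numS + I.numQ) (bestTime I + candTime I + 10) (fun y σ' => Consts I σ' ∧
    Input I σ' ∧ Table I σ' 0 ∧ σ'.reg 22 = y ∧ σ'.reg 23 = I.numS + I.numQ ∧
    ∃ c, Traced I y c σ' ∧ σ'.reg 20 = code I c) ?_ ?_ ?_).mono ?_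
  · exact ⟨hc.frame (by simp [frame_set, Frame.refl]), hin.congr (by simp [State.mem_set]),
      hT.congr (by simp [State.mem_set]), by simp [State.reg_set], by simp [State.reg_set],
      _, Traced.zero I _, by simp [State.reg_set, code_start]⟩
  · rintro y hy τ ⟨hcτ, hinτ, hTτ, h22, h23, c, htr, h20⟩
    refine ⟨by simp [Test.Holds, h22, h23, hy], ?_⟩
    obtain ⟨i, j, a, b⟩ := c
    have hcap := htr.value_lt_cap
    obtain ⟨hr, hij⟩ : InRange I ⟨i, j, a, b⟩ ∧ i + j = y := by
      obtain ⟨g, posS, J, posQ, hp, hg, hrec, hr, hy⟩ := htr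
      exact ⟨hr, hy⟩
    have hi := hr.i
    have hj := hr.j
    simp only at hi hj
    refine runs_seq.2 ((bestProg_runs hB hcτ hinτ hTτ hr (Nat.zero_le _) h20).mono ?_)
    rintro t₁ τ₁ ⟨ht₁, hmem₁, hf₁, hh₁, -, hbest⟩
    obtain ⟨x, w, c', hm, hv⟩ := hbest.exists_move hcap (by simp only; omega)
    have hu := hm.index_lt
    have hc₁ := hcτ.frame (hf₁.mono (by norm_num))
    generalize hu' : τ₁.reg 31 = u at *
    have hwid : 2 * width I = 2 * (2 * I.k + 1) := rfl
    simp only [runs_seq (P₁ := 33 ≔ _), runs_assign, Rhs.eval, hu']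
    refine ⟨by omega, runs_seq.2 ((candProg_runs (c := ⟨i, j, a, b⟩) (u := u) (n := 0) hB
      (hc₁.frame ?_) (hinτ.congr ?_) (hTτ.congr ?_) hr (Nat.zero_le _) (hh₁.frame ?_) ?_
      hu).mono ?_)⟩
    · simp [frame_set, Frame.refl]
    · simp [State.mem_set, hmem₁]
    · simp [State.mem_set, hmem₁]
    · simp [frame_set, Frame.refl]
    · simp [State.reg_set]
    rintro t₂ τ₂ ⟨ht₂, hmem₂, hf₂, htried⟩
    have g33 := hf₂ 33 (by norm_num)
    have hf₂' : Frame 28 τ₁ τ₂ := by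
      simpa [frame_set_left] using hf₂.mono (n' := 28) (by norm_num)
    have hh₂ := hh₁.frame hf₂'
    have g22 := (hf₂' 22 (by norm_num)).trans ((hf₁ 22 (by norm_num)).trans h22)
    have g23 := (hf₂' 23 (by norm_num)).trans ((hf₁ 23 (by norm_num)).trans h23)
    have hc₂ := hc₁.frame (hf₂'.mono (by norm_num))
    simp only [State.mem_set, State.reg_set, if_true, hmem₁] at hmem₂ g33
    obtain ⟨x', w', c'', hm', -, h35, h36⟩ := htried.resolve_right
      (fun h => h.2 _ _ _ hm)
    obtain ⟨rfl, rfl, rfl⟩ := hm.unique hm'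
    obtain ⟨hr', -⟩ := hm.inRange hr
    have hlt' := hr'.code_lt
    cases hm with
    | student s hi' hs =>
      have hs2 := s.2
      have hlt : (I.α s : ℕ) + I.k - i < width I := by
        have := hs.2.1
        unfold width
        omega
      simp only [runs_seq, runs_branch, runs_store, runs_assign, Rhs.eval, Op.eval, Test.Holds,
        State.reg_set, State.reg_write, if_true, if_false, Nat.reduceEqDiff, OfNat.one_ne_ofNat,
        g33, h36, h35, g22, g23, hc₂.out, hc₂.width, hc₂.size, hc₂.one, hh₂.i, hh₂.j, hlt,
        not_true_eq_false, false_implies, true_implies, and_true, true_and]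
      refine ⟨by omega, by omega, by omega, by omega, by omega, by omega, by omega, by omega,
        hc₂.frame ?_, hinτ.congr ?_, ?_, _, htr.student hi' hs hv ?_, rfl⟩
      · simp [frame_set, frame_write, Frame.refl]
      · intro x hx
        simp only [State.mem_set, State.mem_write, hmem₂]
        rw [if_neg (by omega), if_neg (by omega)]
      · intro c hr hn
        simp only [State.mem_set, State.mem_write, hmem₂]
        rw [if_neg (by omega), if_neg (by omega)]
        exact hTτ c hr hn
      · intro x
        simp only [State.mem_set, State.mem_write, hmem₂]
        have : inputSize I + (s : ℕ) + 1 = inputSize I + 1 + s := by ring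
        rw [this]
    | question q hj' hq =>
      have hq2 := q.2
      have hlt : ¬ (2 * I.k + 1 + ((I.β q : ℕ) + I.k - j) < width I) := by
        unfold width
        omega
      simp only [runs_seq, runs_branch, runs_store, runs_assign, Rhs.eval, Op.eval, Test.Holds,
        State.reg_set, State.reg_write, if_true, if_false, Nat.reduceEqDiff, OfNat.one_ne_ofNat,
        g33, h36, h35, g22, g23, hc₂.out, hc₂.width, hc₂.size, hc₂.one, hh₂.i, hh₂.j, hlt,
        not_false_eq_true, false_implies, true_implies, and_true, true_and]
      refine ⟨by omega, by omega, by omega, by omega, by omega, by omega,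
        hc₂.frame ?_, hinτ.congr ?_, ?_, _, htr.question hj' hq hv ?_, rfl⟩
      · simp [frame_set, frame_write, Frame.refl]
      · intro x hx
        simp only [State.mem_set, State.mem_write, hmem₂]
        rw [if_neg (by omega)]
      · intro c hr hn
        simp only [State.mem_set, State.mem_write, hmem₂]
        rw [if_neg (by omega)]
        exact hTτ c hr hn
      · intro x
        simp only [State.mem_set, State.mem_write, hmem₂]
        have : inputSize I + (I.numS + (q : ℕ)) + 1 = inputSize I + 1 + I.numS + q := by ring
        rw [this]
  · rintro τ ⟨hcτ, hinτ, hTτ, h22, h23, -⟩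
    simp [Test.Holds, h22, h23]
  · rintro t τ ⟨ht, hcτ, hinτ, hTτ, h22, h23, c, htr, -⟩
    have : bestTime I + candTime I + 10 + 1 = bestTime I + candTime I + 11 := rfl
    rw [this] at ht
    exact ⟨by unfold traceTime; omega, hcτ, hinτ, hTτ, c, htr⟩

/-! ### The edit matrix -/

/-- Writes the minimum number of edits and the matrix of the edit set. -/
def matrixProg : Prog :=
  20 ≔ .load rTab ;; .store rOut 20 ;; 21 ≔ .const 0 ;; 22 ≔ .op .mul rNumS rNumQ ;;
  .loop (.lt 21 22)
    (24 ≔ .op .div 21 rNumQ ;; 25 ≔ .op .mul 24 rNumQ ;; 25 ≔ .op .sub 21 25 ;;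
      26 ≔ .op .add rSize 24 ;; 26 ≔ .load 26 ;;
      27 ≔ .op .add rOut rOne ;; 27 ≔ .op .add 27 rNumS ;; 28 ≔ .op .add 27 25 ;; 28 ≔ .load 28 ;;
      30 ≔ .op .add rEdges 21 ;; 30 ≔ .load 30 ;;
      27 ≔ .op .add 27 rNumQ ;; 27 ≔ .op .add 27 21 ;;
      .branch (.lt 28 26) (31 ≔ .op .sub rOne 30) (31 ≔ .copy 30) ;;
      .store 27 31 ;; 21 ≔ .op .add 21 rOne)

theorem matrixProg_runs {I : NearInstance} {B : ℕ} {σ : State} {J : Fin I.numS → ℕ}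
    {posQ : Fin I.numQ → ℕ} (hB : 20 * states I ≤ B) (hc : Consts I σ) (hin : Input I σ)
    (hT : Table I σ 0) (hJ : ∀ s : Fin I.numS, σ.mem (2 * inputSize I + s) = J s)
    (hposQ : ∀ q : Fin I.numQ, σ.mem (inputSize I + 1 + I.numS + q) = posQ q)
    (hJle : ∀ s, J s ≤ I.numQ) (hposQlt : ∀ q, posQ q < I.numQ) :
    Runs B matrixProg σ fun t σ' => t ≤ I.numS * I.numQ * 18 + 5 ∧ Consts I σ' ∧
      σ'.mem (inputSize I) = value I ⟨0, 0, 0, 0⟩ ∧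
      (∀ s : Fin I.numS, σ'.mem (inputSize I + 1 + s) = σ.mem (inputSize I + 1 + s)) ∧
      (∀ q : Fin I.numQ, σ'.mem (inputSize I + 1 + I.numS + q) = posQ q) ∧
      ∀ (s : Fin I.numS) (q : Fin I.numQ),
        σ'.mem (inputSize I + 1 + I.numS + I.numQ + (I.numQ * s + q)) =
        if ((s, q) ∈ I.edges ↔ posQ q < J s) then 0 else 1 := by
  obtain ⟨hs1, hs2, hs3, hs4⟩ := le_states I
  have hsz : inputSize I = 3 + I.numS + I.numQ + I.numS * I.numQ := rfl
  have hval := hT _ (inRange_start I) (Nat.zero_le _)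
  rw [code_start, add_zero] at hval
  have hle := value_start_lt_cap I
  unfold cap at hle
  simp only [matrixProg, runs_seq (P₁ := 20 ≔ _), runs_seq (P₁ := .store rOut _),
    runs_seq (P₁ := 21 ≔ .const _), runs_seq (P₁ := 22 ≔ _), runs_assign, runs_store, Rhs.eval,
    Op.eval, State.reg_set, State.reg_write, if_true, if_false, Nat.reduceEqDiff,
    OfNat.one_ne_ofNat, hc.tab, hc.out, hval, hc.numS, hc.numQ]
  refine ⟨by omega, by omega, by omega, by omega, ?_⟩
  refine (runs_loop (I.numS * I.numQ) 17 (fun y σ' => Consts I σ' ∧ σ'.reg 21 = y ∧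
    σ'.reg 22 = I.numS * I.numQ ∧ σ'.mem (inputSize I) = value I ⟨0, 0, 0, 0⟩ ∧
    (∀ a, a ≠ inputSize I → (a < inputSize I + 1 + I.numS + I.numQ ∨ 2 * inputSize I ≤ a) →
      σ'.mem a = σ.mem a) ∧
    ∀ (s : Fin I.numS) (q : Fin I.numQ), I.numQ * (s : ℕ) + q < y →
      σ'.mem (inputSize I + 1 + I.numS + I.numQ + (I.numQ * s + q)) =
        if ((s, q) ∈ I.edges ↔ posQ q < J s) then 0 else 1) ?_ ?_ ?_).mono ?_
  · refine ⟨hc.frame (by simp [frame_set, frame_write, Frame.refl]), by simp [State.reg_set],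
      by simp [State.reg_set], by simp [State.mem_set, State.mem_write], ?_, by simp⟩
    intro a ha _
    simp [State.mem_set, State.mem_write, ha]
  · rintro y hy τ ⟨hcτ, h21, h22, hval', hsame, hmat⟩
    have hp : 0 < I.numQ := Nat.pos_of_ne_zero fun h => by simp [h] at hy
    have hdiv : y / I.numQ < I.numS := Nat.div_lt_of_lt_mul (by rwa [mul_comm] at hy)
    have hmod : y % I.numQ < I.numQ := Nat.mod_lt _ hp
    have hy' : I.numQ * (y / I.numQ) + y % I.numQ = y := Nat.div_add_mod _ _
    have hymod : y - y / I.numQ * I.numQ = y % I.numQ := by rw [mul_comm]; omega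
    have hymul : y / I.numQ * I.numQ ≤ y := Nat.div_mul_le_self _ _
    have hdle : y / I.numQ ≤ y := Nat.div_le_self _ _
    generalize hd : y / I.numQ = d at *
    generalize y % I.numQ = r at *
    have m1 := (hsame (2 * inputSize I + d) (by omega) (by omega)).trans
      (hJ ⟨_, hdiv⟩)
    have m2 := (hsame (inputSize I + 1 + I.numS + r) (by omega) (by omega)).trans
      (hposQ ⟨_, hmod⟩)
    have m3 := (hsame (3 + I.numS + I.numQ + y) (by omega) (by omega))
    have m4 := hin.edges ⟨_, hdiv⟩ ⟨_, hmod⟩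
    simp only [hy'] at m4
    rw [m4] at m3
    have hJ' := hJle ⟨_, hdiv⟩
    have hQ' := hposQlt ⟨_, hmod⟩
    refine ⟨by simp [Test.Holds, h21, h22, hy], ?_⟩
    have hle1 : (if ((⟨d, hdiv⟩ : Fin I.numS), (⟨r, hmod⟩ : Fin I.numQ)) ∈
      I.edges then 1 else 0) ≤ 1 := by split_ifs <;> simp
    generalize he : (if ((⟨d, hdiv⟩ : Fin I.numS), (⟨r, hmod⟩ : Fin I.numQ)) ∈
      I.edges then 1 else 0) = e at m3 hle1
    -- writing the right entry `v` to the next cell of the matrix keeps the invariant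
    have hnew : ∀ v, (v = if ((⟨d, hdiv⟩, ⟨r, hmod⟩) ∈ I.edges ↔
        posQ ⟨r, hmod⟩ < J ⟨d, hdiv⟩) then 0 else 1) → ∀ τ' : State,
        (∀ a, τ'.mem a = if a = inputSize I + 1 + I.numS + I.numQ + y then v else τ.mem a) →
        τ'.mem (inputSize I) = value I ⟨0, 0, 0, 0⟩ ∧
        (∀ a, a ≠ inputSize I → (a < inputSize I + 1 + I.numS + I.numQ ∨ 2 * inputSize I ≤ a) →
          τ'.mem a = σ.mem a) ∧
        ∀ (s : Fin I.numS) (q : Fin I.numQ), I.numQ * (s : ℕ) + q < y + 1 →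
          τ'.mem (inputSize I + 1 + I.numS + I.numQ + (I.numQ * s + q)) =
            if ((s, q) ∈ I.edges ↔ posQ q < J s) then 0 else 1 := by
      intro v hv τ' hτ'
      refine ⟨by rw [hτ', if_neg (by omega), hval'], ?_, ?_⟩
      · intro a ha ha'
        rw [hτ', if_neg (by omega), hsame a ha ha']
      · intro s q hsq
        rw [hτ']
        split_ifs with h1 h2 h2
        all_goals try rw [hmat s q (by omega)]; simp [h2]
        all_goals
          obtain ⟨e1, e2⟩ := mul_add_inj (w := I.numQ) (x := s) (y := q) (x' := d)
            (y' := r) q.2 hmod (by rw [mul_comm, mul_comm (d)]; omega)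
          have e1' : s = ⟨d, hdiv⟩ := Fin.ext e1
          have e2' : q = ⟨r, hmod⟩ := Fin.ext e2
          subst e1' e2'
          rw [hv]
          simp [h2]
    simp only [runs_seq, runs_branch, runs_store, runs_assign, Rhs.eval, Op.eval, Test.Holds,
      State.reg_set, State.reg_write, State.mem_set, if_true, if_false, Nat.reduceEqDiff,
      OfNat.one_ne_ofNat, OfNat.ofNat_ne_one, h21, h22, hd, hcτ.numQ, hcτ.numS, hcτ.size, hcτ.out,
      hcτ.one, hcτ.edges, hymod, m1, m2, m3]
    refine ⟨by omega, by omega, by omega, by omega, by omega, by omega, by omega, by omega,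
      by omega, by omega, by omega, by omega, by omega, ?_, ?_⟩
    · intro hlt
      refine ⟨by omega, by omega, by omega, by omega, hcτ.frame ?_, trivial, trivial,
        hnew (1 - e) ?_ _ ?_⟩
      · simp [frame_set, frame_write, Frame.refl]
      · simp only [← he, hlt, iff_true]
        split_ifs <;> rfl
      · intro a
        simp only [State.mem_set, State.mem_write]
    · intro hlt
      refine ⟨by omega, by omega, by omega, by omega, hcτ.frame ?_, trivial, trivial,
        hnew e ?_ _ ?_⟩
      · simp [frame_set, frame_write, Frame.refl]
      · simp only [← he, hlt, iff_false, ite_not]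
      · intro a
        simp only [State.mem_set, State.mem_write]
  · rintro τ ⟨hcτ, h21, h22, -⟩
    simp [Test.Holds, h21, h22]
  · rintro t τ ⟨ht, hcτ, h21, h22, hval', hsame, hmat⟩
    refine ⟨by omega, hcτ, hval', fun s => hsame _ (by omega) (by omega), fun q => ?_,
      fun s q => hmat s q (mul_add_lt s q)⟩
    rw [hsame _ (by omega) (by omega), hposQ]

/-! ### Moving the output -/

/-- Moves the output to the start of the memory.  The output is shorter than the input, after which
it was built, so the source and the target are disjoint. -/
def copyProg : Prog :=
  21 ≔ .const 0 ;;
  .loop (.lt 21 rLen) (22 ≔ .op .add rOut 21 ;; 22 ≔ .load 22 ;; .store 21 22 ;;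
    21 ≔ .op .add 21 rOne)

theorem copyProg_runs {I : NearInstance} {B : ℕ} {σ : State} {l : List ℕ}
    (hB : 20 * states I ≤ B) (hc : Consts I σ) (hl : l.length = inputSize I - 2)
    (hmem : ∀ (a : ℕ) (h : a < l.length), σ.mem (inputSize I + a) = l[a])
    (hle : ∀ x ∈ l, x ≤ B) :
    Runs B copyProg σ fun t σ' => t ≤ inputSize I * 5 + 2 ∧ σ'.Outputs l := by
  obtain ⟨hs1, hs2, hs3, hs4⟩ := le_states I
  have hsz : inputSize I = 3 + I.numS + I.numQ + I.numS * I.numQ := rfl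
  simp only [copyProg, runs_seq (P₁ := 21 ≔ .const _), runs_assign, Rhs.eval]
  refine ⟨by omega, ?_⟩
  refine (runs_loop (inputSize I - 2) 4 (fun y σ' => Consts I σ' ∧ σ'.reg 21 = y ∧
    (∀ a, inputSize I ≤ a → σ'.mem a = σ.mem a) ∧
    ∀ (a : ℕ) (h : a < l.length), a < y → σ'.mem a = l[a]) ?_ ?_ ?_).mono ?_
  · exact ⟨hc.frame (by simp [frame_set, Frame.refl]), by simp [State.reg_set],
      by simp [State.mem_set], by simp⟩
  · rintro y hy τ ⟨hcτ, h21, hsame, hcopy⟩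
    have hy' : y < l.length := by omega
    have h1 := (hsame (inputSize I + y) (by omega)).trans (hmem y hy')
    have h2 := hle _ (List.getElem_mem hy')
    refine ⟨by simp [Test.Holds, h21, hcτ.len, hy], ?_⟩
    simp only [runs_seq, runs_store, runs_assign, Rhs.eval, Op.eval, State.reg_set, State.reg_write,
      State.mem_set, if_true, if_false, Nat.reduceEqDiff, OfNat.one_ne_ofNat, OfNat.ofNat_ne_one,
      h21, hcτ.out, hcτ.one, h1]
    refine ⟨by omega, by omega, by omega, by omega, by omega, hcτ.frame ?_, trivial, ?_, ?_⟩
    · simp [frame_set, frame_write, Frame.refl]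
    · intro a ha
      rw [State.mem_write, if_neg (by omega), State.mem_set, State.mem_set, hsame a ha]
    · intro a ha hay
      rw [State.mem_write]
      split_ifs with h
      · simp [h]
      · rw [State.mem_set, State.mem_set, hcopy a ha (by omega)]
  · rintro τ ⟨hcτ, h21, -⟩
    simp [Test.Holds, h21, hcτ.len]
  · rintro t τ ⟨ht, hcτ, h21, hsame, hcopy⟩
    exact ⟨by omega, fun a h => hcopy a h (by omega)⟩

/-! ### Encodings -/

section Encoding
variable {m p : ℕ} (hd : List ℕ) (π : Fin m ≃ Fin m) (τ : Fin p ≃ Fin p)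
  (E : Finset (Fin m × Fin p))

theorem getElem?_encoding_fst (s : Fin m) :
    (hd ++ permList π ++ permList τ ++ matrixList E)[hd.length + s]? = some (π s : ℕ) := by
  rw [List.append_assoc, List.append_assoc, List.getElem?_append_right (by omega),
    List.getElem?_append_left (by simp [permList])]
  simp [permList]

theorem getElem?_encoding_snd (q : Fin p) :
    (hd ++ permList π ++ permList τ ++ matrixList E)[hd.length + m + q]? = some (τ q : ℕ) := by
  rw [List.append_assoc, List.getElem?_append_right (by simp [permList]),
    List.getElem?_append_left (by simp [permList])]
  simp [permList]

theorem getElem?_encoding_matrix (s : Fin m) (q : Fin p) :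
    (hd ++ permList π ++ permList τ ++ matrixList E)[hd.length + m + p + (p * s + q)]? =
      some (if (s, q) ∈ E then 1 else 0) := by
  have hlt := mul_add_lt s q
  have he : finProdFinEquiv.symm (⟨p * s + q, hlt⟩ : Fin (m * p)) = (s, q) := by
    rw [Equiv.symm_apply_eq]
    exact Fin.ext (by simp [finProdFinEquiv, add_comm])
  rw [List.getElem?_append_right (by simp [permList]; omega)]
  have hidx : hd.length + m + p + (p * s + q) - (hd ++ permList π ++ permList τ).length =
      p * s + q := by
    simp only [permList, List.length_append, List.length_ofFn]
    omega
  rw [hidx, matrixList, List.getElem?_ofFn, dif_pos hlt, he]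

/-- A memory that agrees with the four blocks of an encoding contains the encoding. -/
theorem eq_encoding {f : ℕ → ℕ} (h₀ : ∀ (a : ℕ) (h : a < hd.length), f a = hd[a])
    (h₁ : ∀ s : Fin m, f (hd.length + s) = π s) (h₂ : ∀ q : Fin p, f (hd.length + m + q) = τ q)
    (h₃ : ∀ (s : Fin m) (q : Fin p), f (hd.length + m + p + (p * s + q)) =
      if (s, q) ∈ E then 1 else 0)
    (a : ℕ) (h : a < (hd ++ permList π ++ permList τ ++ matrixList E).length) :
    f a = (hd ++ permList π ++ permList τ ++ matrixList E)[a] := by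
  have hlen : (hd ++ permList π ++ permList τ ++ matrixList E).length =
    hd.length + m + p + m * p := by simp [permList, matrixList, add_assoc]
  rw [eq_comm, List.getElem_eq_iff]
  by_cases c0 : a < hd.length
  · rw [h₀ a c0, List.append_assoc, List.append_assoc, List.getElem?_append_left c0,
      List.getElem?_eq_getElem c0]
  obtain ⟨a, rfl⟩ := Nat.exists_eq_add_of_le (not_lt.1 c0)
  by_cases c1 : a < m
  · rw [h₁ ⟨a, c1⟩, ← getElem?_encoding_fst hd π τ E ⟨a, c1⟩]
  obtain ⟨a, rfl⟩ := Nat.exists_eq_add_of_le (not_lt.1 c1)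
  by_cases c2 : a < p
  · rw [← add_assoc, h₂ ⟨a, c2⟩, ← getElem?_encoding_snd hd π τ E ⟨a, c2⟩]
  obtain ⟨a, rfl⟩ := Nat.exists_eq_add_of_le (not_lt.1 c2)
  have c3 : a < m * p := by omega
  have hp : 0 < p := Nat.pos_of_ne_zero fun h => by simp [h] at c3
  have c4 : a / p < m := Nat.div_lt_of_lt_mul (by rwa [mul_comm] at c3)
  have c5 := Nat.mod_lt a hp
  have h3 := h₃ ⟨_, c4⟩ ⟨_, c5⟩
  have h4 := getElem?_encoding_matrix hd π τ E ⟨_, c4⟩ ⟨_, c5⟩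
  simp only [Nat.div_add_mod] at h3 h4
  rw [← add_assoc, ← add_assoc, h3, h4]

end Encoding

theorem input_initial (I : NearInstance) : Input I I.initial := by
  constructor
  · intro s
    have := getElem?_encoding_fst [I.numS, I.numQ, I.k] I.α I.β I.edges s
    simp only [NearInstance.initial, NearInstance.encode, List.getD_eq_getElem?_getD]
    exact congrArg (Option.getD · 0) this
  · intro q
    have := getElem?_encoding_snd [I.numS, I.numQ, I.k] I.α I.β I.edges q
    simp only [NearInstance.initial, NearInstance.encode, List.getD_eq_getElem?_getD]
    exact congrArg (Option.getD · 0) this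
  · intro s q
    have := getElem?_encoding_matrix [I.numS, I.numQ, I.k] I.α I.β I.edges s q
    simp only [NearInstance.initial, NearInstance.encode, List.getD_eq_getElem?_getD]
    exact congrArg (Option.getD · 0) this

/-! ### Initialisation -/

/-- Computes the constants of the instance. -/
def initProg : Prog :=
  rOne ≔ .const 1 ;; rTwo ≔ .const 2 ;; rThree ≔ .const 3 ;;
  rNumS ≔ .load rZero ;; rNumQ ≔ .load rOne ;; rK ≔ .load rTwo ;;
  rWidth ≔ .op .add rK rK ;; rWidth ≔ .op .add rWidth rOne ;; 61 ≔ .copy rWidth ;; powProg ;;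
  rMasks ≔ .copy 63 ;; rCols ≔ .op .add rNumQ rOne ;;
  rStates ≔ .op .add rNumS rOne ;; rStates ≔ .op .mul rStates rCols ;;
  rStates ≔ .op .mul rStates rMasks ;; rStates ≔ .op .mul rStates rMasks ;;
  rCap ≔ .op .mul rNumS rNumQ ;; rBeta ≔ .op .add rThree rNumS ;;
  rEdges ≔ .op .add rBeta rNumQ ;; rOut ≔ .op .add rEdges rCap ;; rCap ≔ .op .add rCap rOne ;;
  rSize ≔ .op .add rOut rOut ;; rTab ≔ .op .add rSize rOut ;; rMoves ≔ .op .add rWidth rWidth ;;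
  rLen ≔ .op .sub rOut rTwo

theorem initProg_runs {I : NearInstance} {B : ℕ} (hB : 20 * states I ≤ B) :
    Runs B initProg I.initial fun t σ' => t ≤ 3 * width I + 30 ∧ Consts I σ' ∧ Input I σ' := by
  obtain ⟨hs1, hs2, hs3, hs4⟩ := le_states I
  have hsz : inputSize I = 3 + I.numS + I.numQ + I.numS * I.numQ := rfl
  have hst : (I.numS + 1) * (I.numQ + 1) * masks I * masks I = states I := rfl
  have m0 : I.initial.mem 0 = I.numS := rfl
  have m1 : I.initial.mem 1 = I.numQ := rfl
  have m2 : I.initial.mem 2 = I.k := rfl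
  have hr : ∀ r, I.initial.reg r = 0 := fun _ => rfl
  have hwid : width I = I.k + I.k + 1 := by unfold width; omega
  have b1 : (I.numS + 1) * (I.numQ + 1) * masks I ≤ states I :=
    Nat.le_mul_of_pos_right _ (by omega)
  have b2 : (I.numS + 1) * (I.numQ + 1) ≤ (I.numS + 1) * (I.numQ + 1) * masks I :=
    Nat.le_mul_of_pos_right _ (by omega)
  simp only [initProg, runs_seq (P₁ := rOne ≔ _), runs_seq (P₁ := rTwo ≔ _),
    runs_seq (P₁ := rThree ≔ _), runs_seq (P₁ := rNumS ≔ _), runs_seq (P₁ := rNumQ ≔ _),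
    runs_seq (P₁ := rK ≔ _), runs_seq (P₁ := rWidth ≔ _), runs_seq (P₁ := 61 ≔ _), runs_assign,
    Rhs.eval, Op.eval, State.reg_set, State.mem_set, if_true, if_false, Nat.reduceEqDiff,
    OfNat.one_ne_ofNat, OfNat.ofNat_ne_one, OfNat.zero_ne_ofNat, zero_ne_one, m0, m1, m2, hr,
    ← hwid]
  refine ⟨by omega, by omega, by omega, by omega, by omega, by omega, by omega, by omega, by omega,
    ?_⟩
  refine runs_seq.2 ((powProg_runs (e := width I) ?_ ?_ ?_).mono ?_)
  · simp [State.reg_set]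
  · simp [State.reg_set]
  · exact hs2.trans (by omega)
  rintro t τ ⟨ht, hmem, hf, h63⟩
  have g0 := hf rZero (by norm_num)
  have g1 := hf rNumS (by norm_num)
  have g2 := hf rNumQ (by norm_num)
  have g3 := hf rK (by norm_num)
  have g4 := hf rWidth (by norm_num)
  have g6 := hf rOne (by norm_num)
  have g7 := hf rTwo (by norm_num)
  have g9 := hf rThree (by norm_num)
  have g63 : τ.reg 63 = masks I := h63
  simp only [State.reg_set, State.mem_set, if_true, if_false, Nat.reduceEqDiff, OfNat.one_ne_ofNat,
    OfNat.ofNat_ne_one, OfNat.zero_ne_ofNat, zero_ne_one, hr]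
    at g0 g1 g2 g3 g4 g6 g7 g9 hmem
  simp only [runs_seq, runs_assign, Rhs.eval, Op.eval, State.reg_set, if_true, if_false,
    Nat.reduceEqDiff, OfNat.one_ne_ofNat, OfNat.ofNat_ne_one, g1, g2, g4, g6, g7, g9, g63, hst]
  refine ⟨by omega, by omega, by omega, by omega, by omega, by omega, by omega, by omega, by omega,
    by omega, by omega, by omega, by omega, by omega, by omega, by omega, ?_,
    (input_initial I).congr fun a _ => by simp only [State.mem_set, hmem]⟩
  constructor <;> simp only [State.reg_set, if_true, if_false, Nat.reduceEqDiff,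
    OfNat.one_ne_ofNat, OfNat.ofNat_ne_one, OfNat.zero_ne_ofNat, zero_ne_one, g0, g1, g2, g3, g4,
    g6, g7, g9, g63, cap] <;> first | rfl | omega

/-! ### Running time -/

/-- The number of pairs of masks is about `16 ^ k`, which `k ^ (4 * k)` absorbs, up to a constant
for `k = 1`. -/
theorem states_mul_le {I : NearInstance} {n : ℕ} (hn : n = I.numS + I.numQ) (hn1 : 1 ≤ n)
    (hk : 1 ≤ I.k) : states I * (n * I.k ^ 2) ≤ 256 * (n ^ 3 * I.k ^ (4 * I.k + 4)) := by
  have h1 : 16 ^ I.k * I.k ^ 2 ≤ 16 * I.k ^ (4 * I.k + 4) := by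
    rcases hk.eq_or_lt with h | h
    · simp [← h]
    · calc 16 ^ I.k * I.k ^ 2 = 2 ^ (4 * I.k) * I.k ^ 2 := by rw [pow_mul]; norm_num
        _ ≤ I.k ^ (4 * I.k) * I.k ^ 4 :=
          Nat.mul_le_mul (Nat.pow_le_pow_left h _) (Nat.pow_le_pow_right hk (by norm_num))
        _ = I.k ^ (4 * I.k + 4) := by rw [pow_add]
        _ ≤ _ := Nat.le_mul_of_pos_left _ (by norm_num)
  have h2 : masks I * masks I = 4 * 16 ^ I.k := by
    have : (16 : ℕ) = 2 ^ 4 := by norm_num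
    rw [masks, ← pow_add, this, ← pow_mul]
    have : 2 * I.k + 1 + (2 * I.k + 1) = 2 + 4 * I.k := by ring
    rw [this, pow_add]
    norm_num
  have h3 : (I.numS + 1) * (I.numQ + 1) ≤ 4 * n ^ 2 := by
    calc (I.numS + 1) * (I.numQ + 1) ≤ (2 * n) * (2 * n) :=
          Nat.mul_le_mul (by omega) (by omega)
      _ = 4 * n ^ 2 := by ring
  calc states I * (n * I.k ^ 2)
      = (I.numS + 1) * (I.numQ + 1) * (masks I * masks I) * (n * I.k ^ 2) := by
        unfold states; ring
    _ ≤ 4 * n ^ 2 * (4 * 16 ^ I.k) * (n * I.k ^ 2) := by rw [h2]; gcongr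
    _ = 16 * n ^ 3 * (16 ^ I.k * I.k ^ 2) := by ring
    _ ≤ 16 * n ^ 3 * (16 * I.k ^ (4 * I.k + 4)) := by gcongr
    _ = _ := by ring

theorem bestTime_add_candTime_le {I : NearInstance} {n : ℕ} (hn : n = I.numS + I.numQ)
    (hn1 : 1 ≤ n) (hk : 1 ≤ I.k) : bestTime I + candTime I ≤ 900 * (n * I.k ^ 2) := by
  have hnk : 1 ≤ n * I.k := Nat.mul_pos hn1 hk
  have h1 : n ≤ n * I.k := Nat.le_mul_of_pos_right _ hk
  have h2 : I.k ≤ n * I.k := Nat.le_mul_of_pos_left _ hn1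
  have h3 : n * I.k ^ 2 = I.k * (n * I.k) := by ring
  have h4 : n * I.k ≤ n * I.k ^ 2 := by rw [h3]; exact Nat.le_mul_of_pos_left _ hk
  have hcand : candTime I ≤ 120 * (n * I.k) := by
    have : I.numQ * (3 * width I + 23) ≤ n * (3 * width I + 23) :=
      Nat.mul_le_mul_right _ (by omega)
    have h5 : n * (3 * width I + 23) = 6 * (n * I.k) + 26 * n := by unfold width; ring
    unfold candTime
    rw [h5] at this
    have : width I = 2 * I.k + 1 := rfl
    omega
  have hbest : 2 * width I * (candTime I + 6) ≤ 6 * I.k * (126 * (n * I.k)) :=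
    Nat.mul_le_mul (by unfold width; omega) (by omega)
  have h6 : 6 * I.k * (126 * (n * I.k)) = 756 * (n * I.k ^ 2) := by ring
  unfold bestTime
  omega

/-- The whole program. -/
def editingProg : Prog := initProg ;; tableProg ;; traceProg ;; matrixProg ;; copyProg

theorem editing_time_le {I : NearInstance} {n : ℕ} (hn : n = I.numS + I.numQ) (hn1 : 1 ≤ n)
    (hk : 1 ≤ I.k) :
    (3 * width I + 30) + ((states I * (bestTime I + 4) + 2) + (traceTime I +
      ((I.numS * I.numQ * 18 + 5) + (inputSize I * 5 + 2)))) ≤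
      1000000 * (n ^ 3 * I.k ^ (4 * I.k + 4)) := by
  obtain ⟨hs1, hs2, hs3, hs4⟩ := le_states I
  have h1 := states_mul_le hn hn1 hk
  have h2 := bestTime_add_candTime_le hn hn1 hk
  have h3 : 1 ≤ n * I.k ^ 2 := Nat.mul_pos hn1 (pow_pos hk 2)
  have h4 : states I ≤ states I * (n * I.k ^ 2) := Nat.le_mul_of_pos_right _ h3
  have h5 : states I * (bestTime I + 4) ≤ 904 * (states I * (n * I.k ^ 2)) := by
    calc states I * (bestTime I + 4) ≤ states I * (904 * (n * I.k ^ 2)) :=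
          Nat.mul_le_mul_left _ (by omega)
      _ = _ := by ring
  have h6 : (I.numS + I.numQ) * (bestTime I + candTime I + 11) ≤
      911 * (states I * (n * I.k ^ 2)) := by
    calc (I.numS + I.numQ) * (bestTime I + candTime I + 11)
        ≤ states I * (911 * (n * I.k ^ 2)) := Nat.mul_le_mul (by omega) (by omega)
      _ = _ := by ring
  have h7 : inputSize I = 3 + I.numS + I.numQ + I.numS * I.numQ := rfl
  have h8 : width I = 2 * I.k + 1 := rfl
  unfold traceTime
  omega

/-- A completed trace is an optimal solution, because its cost is the value of the start and every
feasible solution costs at least that. -/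
theorem Traced.exists_optimal {I : NearInstance} {c : Config} {σ : State}
    (h : Traced I (I.numS + I.numQ) c σ) :
    ∃ (F : Finset (Fin I.numS × Fin I.numQ)) (π : Fin I.numS ≃ Fin I.numS)
      (τ : Fin I.numQ ≃ Fin I.numQ) (J : Fin I.numS → ℕ), IsOptimal I F π τ ∧
      F.card = value I ⟨0, 0, 0, 0⟩ ∧ (∀ s, J s ≤ I.numQ) ∧
      (∀ s q, (s, q) ∈ F ↔ ¬ ((s, q) ∈ I.edges ↔ (τ q : ℕ) < J s)) ∧
      (∀ s : Fin I.numS, σ.mem (inputSize I + 1 + s) = π s) ∧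
      (∀ s : Fin I.numS, σ.mem (2 * inputSize I + s) = J s) ∧
      ∀ q : Fin I.numQ, σ.mem (inputSize I + 1 + I.numS + q) = τ q := by
  obtain ⟨g, posS, J, posQ, hp, hg, hrec, hr, hij⟩ := h
  obtain ⟨i, j, a, b⟩ := c
  have hi := hr.i
  have hj := hr.j
  simp only at hij hi hj
  obtain rfl : i = I.numS := by omega
  obtain rfl : j = I.numQ := by omega
  rw [value_done, add_zero] at hg
  obtain ⟨F, π, τ, hfeas, hcard, hπ, hτ, hF⟩ := hp.exists_feasible
  have hltS : ∀ s, posS s < I.numS := fun s => by rw [← hπ]; exact (π s).2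
  have hltQ : ∀ q, posQ q < I.numQ := fun q => by rw [← hτ]; exact (τ q).2
  refine ⟨F, π, τ, J, ⟨hfeas, fun F' π' τ' h' => ?_⟩, hcard.trans hg,
    fun s => hp.size_le s (hltS s), fun s q => by rw [hF, hτ], fun s => ?_,
    fun s => hrec.size s (hltS s), fun q => ?_⟩
  · rw [hcard, hg]
    exact h'.completion.value_le
  · rw [hrec.student s (hltS s), hπ]
  · rw [hrec.question q (hltQ q), hτ]

theorem editingProg_runs {I : NearInstance} {n B : ℕ} (hn : n = I.numS + I.numQ) (hn1 : 1 ≤ n)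
    (hk : 1 ≤ I.k) (hB : 20 * states I ≤ B) :
    Runs B editingProg I.initial fun t σ => t ≤ 1000000 * (n ^ 3 * I.k ^ (4 * I.k + 4)) ∧
      ∃ F π τ, IsOptimal I F π τ ∧ σ.Outputs (encodeSolution F π τ) := by
  have htime := editing_time_le hn hn1 hk
  obtain ⟨hs1, hs2, hs3, hs4⟩ := le_states I
  have hsz : inputSize I = 3 + I.numS + I.numQ + I.numS * I.numQ := rfl
  refine runs_seq.2 ((initProg_runs hB).mono ?_)
  rintro t₁ σ₁ ⟨ht₁, hc₁, hin₁⟩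
  refine runs_seq.2 ((tableProg_runs hB hc₁ hin₁).mono ?_)
  rintro t₂ σ₂ ⟨ht₂, hc₂, hin₂, hT₂⟩
  refine runs_seq.2 ((traceProg_runs hB hc₂ hin₂ hT₂).mono ?_)
  rintro t₃ σ₃ ⟨ht₃, hc₃, hin₃, hT₃, c, htr⟩
  obtain ⟨F, π, τ, J, hopt, hcard, hJle, hF, hmS, hmJ, hmQ⟩ := htr.exists_optimal
  refine runs_seq.2 ((matrixProg_runs hB hc₃ hin₃ hT₃ hmJ hmQ hJle fun q => (τ q).2).mono ?_)
  rintro t₄ σ₄ ⟨ht₄, hc₄, hm0, hm1, hm2, hm3⟩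
  refine (copyProg_runs (l := encodeSolution F π τ) hB hc₄ ?_ ?_ ?_).mono ?_
  · simp [encodeSolution, permList, matrixList, hsz]
    omega
  · refine eq_encoding [F.card] π τ F (f := fun a => σ₄.mem (inputSize I + a)) ?_ ?_ ?_ ?_
    · intro a ha
      obtain rfl : a = 0 := by simpa using ha
      simpa [hcard] using hm0
    · intro s
      simp only [List.length_singleton, ← add_assoc]
      rw [hm1, hmS]
    · intro q
      simp only [List.length_singleton, ← add_assoc]
      rw [hm2]
    · intro s q
      have := hm3 s q
      simp only [List.length_singleton, ← add_assoc] at this ⊢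
      rw [this]
      by_cases h : ((s, q) ∈ I.edges ↔ (τ q : ℕ) < J s) <;> simp [hF, h]
  · have hle := value_start_lt_cap I
    unfold cap at hle
    intro x hx
    simp only [encodeSolution, permList, matrixList, List.mem_append, List.mem_singleton,
      List.mem_ofFn] at hx
    rcases hx with ((rfl | ⟨s, rfl⟩) | ⟨q, rfl⟩) | ⟨y, rfl⟩
    · omega
    · omega
    · omega
    · split_ifs <;> omega
  · rintro t₅ σ₅ ⟨ht₅, hout⟩
    exact ⟨by omega, F, π, τ, hopt, hout⟩

end NearEditing

/-- One program solves all instances of Both `k`-near Editing in `O(n³ k^(4k+4))` steps on words of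
`O(log (n³ k^(4k+4)))` bits, where `n` is the number of students and questions. -/
theorem mainTheorem3 :
    ∃ (P : NearEditing.Prog) (C : ℕ),
      ∀ (I : NearEditing.NearInstance) (n : ℕ), n = I.numS + I.numQ → 1 ≤ n → 1 ≤ I.k →
        ∃ (t : ℕ) (σ : NearEditing.State),
          NearEditing.Exec (C * (n ^ 3 * I.k ^ (4 * I.k + 4)) ^ C) P I.initial t σ ∧
          t ≤ C * (n ^ 3 * I.k ^ (4 * I.k + 4)) ∧
          ∃ (F : Finset (Fin I.numS × Fin I.numQ)) (π : Fin I.numS ≃ Fin I.numS)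
            (τ : Fin I.numQ ≃ Fin I.numQ),
            NearEditing.IsOptimal I F π τ ∧
            σ.Outputs (NearEditing.encodeSolution F π τ) := by
  -- the constant is kept abstract, as it also occurs as an exponent
  obtain ⟨C, hC⟩ : ∃ C : ℕ, C = 1000000 := ⟨_, rfl⟩
  refine ⟨NearEditing.editingProg, C, fun I n hn hn1 hk => ?_⟩
  refine (NearEditing.editingProg_runs hn hn1 hk ?_).mono fun t σ h => ⟨hC ▸ h.1, h.2⟩
  have h1 := NearEditing.states_mul_le hn hn1 hk
  have h2 : NearEditing.states I ≤ NearEditing.states I * (n * I.k ^ 2) :=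
    Nat.le_mul_of_pos_right _ (Nat.mul_pos hn1 (pow_pos hk 2))
  have h3 : 1 ≤ n ^ 3 * I.k ^ (4 * I.k + 4) := Nat.mul_pos (pow_pos hn1 3) (pow_pos hk _)
  have h4 := Nat.le_self_pow (n := C) (by omega) (n ^ 3 * I.k ^ (4 * I.k + 4))
  calc 20 * NearEditing.states I ≤ 1000000 * (n ^ 3 * I.k ^ (4 * I.k + 4)) := by omega
    _ = C * (n ^ 3 * I.k ^ (4 * I.k + 4)) := by rw [hC]
    _ ≤ _ := Nat.mul_le_mul_left _ h4
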